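/- Let $G$ be a locally compact Hausdorff étale groupoid with unit space $G^0$, range map $r$ and source map $s$. A Fell bundle $\mathcal A=(A_g)_{g\in G}$ over $G$ is an upper semicontinuous Banach bundle over $G$ with a continuous, bilinear, associative multiplication $A_g\times A_h\to A_{gh}$ (for $s(g)=r(h)$) and a continuous conjugate-linear involution $A_g\to A_{g^{-1}}$ such that $(ab)^*=b^*a^*$, $a^{**}=a$, $\|ab\|\le\|a\|\|b\|$, $\|a^*a\|=\|a\|^2$, and $a^*a$ is positive in the $C^*$-algebra $A_{s(g)}$ for $a\in A_g$. A morphism $\varphi:\mathcal A\to\mathcal B$ of Fell bundles over $G$ is a continuous map that restricts to linear maps $A_g\to B_g$ and preserves the multiplication and the involution; it induces the $*$-homomorphism $\varphi^c:\Gamma_c(\mathcal A)\to\Gamma_c(\mathcal B)$, $\varphi^c(f)=\varphi\circ f$. Here $\Gamma_c(\mathcal A)$ is the $*$-algebra of compactly supported continuous sections, with $(f_1f_2)(g)=\sum_{hk=g}f_1(h)f_2(k)$ and $f^*(g)=f(g^{-1})^*$. Let $\mathcal A^0=\mathcal A|_{G^0}$, and let $P_{\mathcal A}:\Gamma_c(\mathcal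 A)\to\Gamma_c(\mathcal A^0)\subseteq\Gamma_c(\mathcal A)$ be restriction to the clopen set $G^0$ (extended by $0$). Let $L^2(\mathcal A)$ be the Hilbert module obtained by completing $\Gamma_c(\mathcal A)$ in the norm $\|f\|_2=\|\langle f,f\rangle\|_\infty^{1/2}$, where $\langle f_1,f_2\rangle=P_{\mathcal A}(f_1^*f_2)$. Left multiplication extends to a representation $i_{\mathcal A,r}$ of $\Gamma_c(\mathcal A)$ by adjointable operators on $L^2(\mathcal A)$, and $C^*_r(\mathcal A)$ is the operator norm closure of $i_{\mathcal A,r}(\Gamma_c(\mathcal A))$. A topological $G$-grading of a $C^*$-algebra $A$ is a pair $(\mathcal A,i)$ of a Fell bundle $\mathcal A$ over $G$ and an injective $*$-homomorphism $i:\Gamma_c(\mathcal A)\to A$ with dense range, such that there is a conditional expectation $E$ of $A$ onto $\overline{i(\Gamma_c(\mathcal A^0))}\cong\Gamma_0(\mathcal A^0)$ with $E\circ i=i\circ P_{\mathcal A}$. Let $\mathcal C^{\rm top}_G$ be the category whose objects are the triples $(A,\mathcal A,i)$ with $(\mathcal A,i)$ a topological $G$-grading of $A$, and whose morphisms $(A,\mathcal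 A,i)\to(B,\mathcal B,j)$ are the pairs $(\phi,\varphi)$ of a $*$-homomorphism $\phi:A\to B$ and a morphism $\varphi:\mathcal A\to\mathcal B$ with $\phi\circ i=j\circ\varphi^c$. **Theorem.** (0) $(\mathcal A,i_{\mathcal A,r})$ is a topological $G$-grading of $C^*_r(\mathcal A)$ for every Fell bundle $\mathcal A$ over $G$; for every morphism $\varphi:\mathcal A\to\mathcal B$ there is a unique $*$-homomorphism $\varphi^n:C^*_r(\mathcal A)\to C^*_r(\mathcal B)$ with $\varphi^n\circ i_{\mathcal A,r}=i_{\mathcal B,r}\circ\varphi^c$; and for every object $(A,\mathcal A,i)$ there is a unique $*$-homomorphism $\eta_{(A,\mathcal A,i)}:A\to C^*_r(\mathcal A)$ with $\eta_{(A,\mathcal A,i)}\circ i=i_{\mathcal A,r}$. Consequently $N(A,\mathcal A,i)=(C^*_r(\mathcal A),\mathcal A,i_{\mathcal A,r})$, $N(\phi,\varphi)=(\varphi^n,\varphi)$ defines a functor $N:\mathcal C^{\rm top}_G\to\mathcal C^{\rm top}_G$, and the morphisms $(\eta_{(A,\mathcal A,i)},\mathrm{id}_{\mathcal A})$ form a natural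 transformation $\eta:\mathrm{id}\to N$. (1) $(N,\eta)$ is an idempotent monad on $\mathcal C^{\rm top}_G$: $N\eta=\eta N$, and $N\eta$ is a natural isomorphism. Let $\mathcal N_G$ be the full subcategory of $\mathcal C^{\rm top}_G$ whose objects are the $X$ for which $\eta_X$ is an isomorphism. (2) $N$ takes its values in $\mathcal N_G$, and the resulting functor $N^\eta:\mathcal C^{\rm top}_G\to\mathcal N_G$ is a left adjoint of the inclusion functor $\mathrm{Inc}:\mathcal N_G\to\mathcal C^{\rm top}_G$. (3) $\mathcal N_G$ is a reflective subcategory of $\mathcal C^{\rm top}_G$. (4) $\eta$ is the unit of the adjunction $N^\eta\dashv\mathrm{Inc}$ in (2). -/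

import Mathlib

open CategoryTheory Topology Filter

universe u

/-- An etale topological groupoid with space of arrows `G`. Units are identified with the
arrows `x` such that `rng x = x`, and `mul g h` is defined exactly when `src g = rng h`. -/
class EtaleGroupoid (G : Type u) [TopologicalSpace G] where
  rng : G → G
  src : G → G
  inv : G → G
  mul : ∀ g h : G, src g = rng h → G
  rng_rng : ∀ g, rng (rng g) = rng g
  src_rng : ∀ g, src (rng g) = rng g
  rng_src : ∀ g, rng (src g) = src g
  src_src : ∀ g, src (src g) = src g
  rng_mul : ∀ g h hc, rng (mul g h hc) = rng g
  src_mul : ∀ g h hc, src (mul g h hc) = src h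
  mul_assoc : ∀ g h k (hgh : src g = rng h) (hhk : src h = rng k),
    mul (mul g h hgh) k ((src_mul g h hgh).trans hhk) =
      mul g (mul h k hhk) (hgh.trans (rng_mul h k hhk).symm)
  rng_mul_self : ∀ g, mul (rng g) g (src_rng g) = g
  mul_src_self : ∀ g, mul g (src g) (rng_src g).symm = g
  rng_inv : ∀ g, rng (inv g) = src g
  src_inv : ∀ g, src (inv g) = rng g
  mul_inv : ∀ g, mul g (inv g) (rng_inv g).symm = rng g
  inv_mul : ∀ g, mul (inv g) g (src_inv g) = src g
  continuous_inv : Continuous inv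
  continuous_mul : Continuous (fun p : {p : G × G // src p.1 = rng p.2} => mul p.1.1 p.1.2 p.2)
  /-- Etaleness: the range map is a local homeomorphism onto the unit space. -/
  isLocalHomeomorph_rng :
    IsLocalHomeomorph (fun g : G => (⟨rng g, rng_rng g⟩ : {x : G // rng x = x}))

namespace EtaleGroupoid

variable {G : Type u} [TopologicalSpace G] [EtaleGroupoid G]

variable (G) in
/-- The unit space of `G`. -/
def unitSpace : Set G := {x | rng x = x}

/-- `IsMul g h k` says that `(g, h)` is a composable pair with product `k`. -/
def IsMul (g h k : G) : Prop := ∃ hc : src g = rng h, mul g h hc = k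

theorem IsMul.rng_eq {g h k : G} (H : IsMul g h k) : rng k = rng g := by
  obtain ⟨hc, rfl⟩ := H; exact rng_mul _ _ _

theorem IsMul.src_eq {g h k : G} (H : IsMul g h k) : src k = src h := by
  obtain ⟨hc, rfl⟩ := H; exact src_mul _ _ _

theorem IsMul.unique {g h k k' : G} (H : IsMul g h k) (H' : IsMul g h k') : k = k' := by
  obtain ⟨hc, rfl⟩ := H; obtain ⟨hc', rfl⟩ := H'; rfl

theorem IsMul.assoc {a b c ab bc : G} (h₁ : IsMul a b ab) (h₂ : IsMul b c bc) {k : G} :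
    IsMul ab c k ↔ IsMul a bc k := by
  obtain ⟨h₁, rfl⟩ := h₁
  obtain ⟨h₂, rfl⟩ := h₂
  constructor
  · rintro ⟨h, rfl⟩; exact ⟨_, (mul_assoc _ _ _ h₁ h₂).symm⟩
  · rintro ⟨h, rfl⟩; exact ⟨_, mul_assoc _ _ _ h₁ h₂⟩

theorem isMul_rng (g : G) : IsMul (rng g) g g := ⟨src_rng g, rng_mul_self g⟩
theorem isMul_src (g : G) : IsMul g (src g) g := ⟨(rng_src g).symm, mul_src_self g⟩
theorem isMul_inv (g : G) : IsMul g (inv g) (rng g) := ⟨(rng_inv g).symm, mul_inv g⟩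
theorem isMul_inv' (g : G) : IsMul (inv g) g (src g) := ⟨src_inv g, inv_mul g⟩

theorem exists_isMul {g h : G} (hc : src g = rng h) : ∃ k, IsMul g h k := ⟨_, hc, rfl⟩

/-- If `g h = k` then `h = g⁻¹ k`. -/
theorem IsMul.inv_left {g h k : G} (H : IsMul g h k) : IsMul (inv g) k h := by
  have h1 : rng h = src g := by obtain ⟨hc, _⟩ := H; exact hc.symm
  exact (IsMul.assoc (isMul_inv' g) H).1 (h1 ▸ isMul_rng h)

/-- If `g h = k` then `g = k h⁻¹`. -/
theorem IsMul.inv_right {g h k : G} (H : IsMul g h k) : IsMul k (inv h) g := by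
  have h1 : rng h = src g := by obtain ⟨hc, _⟩ := H; exact hc.symm
  exact (IsMul.assoc H (isMul_inv h)).2 (h1 ▸ isMul_src g)

theorem inv_inv (g : G) : inv (inv g) = g := by
  have h := (isMul_inv' g).inv_left
  rw [← rng_inv g] at h
  have h2 := isMul_src (inv (inv g))
  rw [src_inv] at h2
  exact h2.unique h

theorem IsMul.inv {g h k : G} (H : IsMul g h k) :
    IsMul (EtaleGroupoid.inv h) (EtaleGroupoid.inv g) (EtaleGroupoid.inv k) := by
  have := H.inv_right.inv_left
  exact this.inv_right

theorem IsMul.left_unique {g g' h k : G} (H : IsMul g h k) (H' : IsMul g' h k) : g = g' :=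
  H.inv_right.unique H'.inv_right

theorem IsMul.right_unique {g h h' k : G} (H : IsMul g h k) (H' : IsMul g h' k) : h = h' :=
  H.inv_left.unique H'.inv_left

theorem src_of_rng {x : G} (hx : rng x = x) : src x = x := by
  rw [← hx, src_rng]

theorem inv_of_rng {x : G} (hx : rng x = x) : inv x = x := by
  have h := isMul_inv x
  rw [hx] at h
  have h2 := h.inv_left.inv_left
  have h3 := isMul_rng (inv x)
  rw [rng_inv, src_of_rng hx] at h3
  exact h3.unique h

theorem isMul_unit {x : G} (hx : rng x = x) : IsMul x x x := by
  have := isMul_rng x; rwa [hx] at this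

theorem continuous_rng : Continuous (rng : G → G) :=
  continuous_subtype_val.comp isLocalHomeomorph_rng.continuous

theorem continuous_src : Continuous (src : G → G) := by
  have : (src : G → G) = fun g => rng (inv g) := by funext g; rw [rng_inv]
  rw [this]; exact continuous_rng.comp continuous_inv

theorem isOpen_unitSpace : IsOpen (unitSpace G) := by
  rw [isOpen_iff_mem_nhds]
  intro x hx
  obtain ⟨e, hxe, he⟩ := isLocalHomeomorph_rng (G := G) x
  have hU : e.source ∈ 𝓝 x := e.open_source.mem_nhds hxe
  have hV : rng ⁻¹' e.source ∈ 𝓝 x := by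
    refine continuous_rng.continuousAt.preimage_mem_nhds ?_
    rw [show rng x = x from hx]; exact hU
  filter_upwards [hU, hV] with g hg hg'
  refine e.injOn hg' hg ?_
  rw [← he]; exact Subtype.ext (rng_rng g)

theorem isClosed_unitSpace [T2Space G] : IsClosed (unitSpace G) :=
  isClosed_eq continuous_rng continuous_id

theorem continuousAt_isMul {X : Type*} [TopologicalSpace X] {α β γ : X → G} {x₀ : X}
    (ha : ContinuousAt α x₀) (hb : ContinuousAt β x₀)
    (H : ∀ᶠ x in 𝓝 x₀, IsMul (α x) (β x) (γ x)) : ContinuousAt γ x₀ := by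
  classical
  let m : G × G → G := fun p => if h : src p.1 = rng p.2 then mul p.1 p.2 h else p.1
  have hm : ContinuousOn m {p : G × G | src p.1 = rng p.2} := by
    rw [continuousOn_iff_continuous_domRestrict]
    refine continuous_mul.congr fun p => ?_
    have : src p.1.1 = rng p.1.2 := p.2
    exact (dif_pos this).symm
  refine ContinuousAt.congr (f := fun x => m (α x, β x)) ?_ ?_
  · exact Tendsto.comp (hm _ H.self_of_nhds.choose)
      (tendsto_nhdsWithin_iff.2 ⟨ha.prodMk hb, H.mono fun x hx => hx.choose⟩)
  · filter_upwards [H] with x hx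
    simp only [m, dif_pos hx.choose]
    exact hx.choose_spec

/-- Fibres of the range map meet a compact set in boundedly many points. -/
theorem exists_bound_rng {K : Set G} (hK : IsCompact K) :
    ∃ M : ℕ, ∀ u : G, {h | h ∈ K ∧ rng h = u}.Finite ∧ {h | h ∈ K ∧ rng h = u}.ncard ≤ M := by
  choose e hxe he using isLocalHomeomorph_rng (G := G)
  obtain ⟨t, -, ht⟩ := hK.elim_nhds_subcover (fun x => (e x).source)
    (fun x _ => (e x).open_source.mem_nhds (hxe x))
  refine ⟨t.card, fun u => ?_⟩
  have key : ∀ h : G, h ∈ K → ∃ x ∈ t, h ∈ (e x).source := by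
    intro h hh; simpa using ht hh
  choose! φ hφt hφs using key
  have hinj : Set.InjOn φ {h | h ∈ K ∧ rng h = u} := by
    rintro a ⟨ha, hau⟩ b ⟨hb, hbu⟩ hab
    refine (e (φ a)).injOn (hφs a ha) (hab ▸ hφs b hb) ?_
    rw [← he]; exact Subtype.ext (hau.trans hbu.symm)
  have hmaps : Set.MapsTo φ {h | h ∈ K ∧ rng h = u} (t : Set G) := fun a ha => hφt a ha.1
  refine ⟨Set.Finite.of_injOn hmaps hinj t.finite_toSet, ?_⟩
  rw [← Set.ncard_coe_finset t]
  exact Set.ncard_le_ncard_of_injOn φ hmaps hinj t.finite_toSet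

end EtaleGroupoid

open EtaleGroupoid

/-- The total space of a family of fibres (without the disjoint union topology). -/
structure BundleTotal {G : Type u} (E : G → Type u) : Type u where
  base : G
  val : E base

/-- Fell bundles over `G`: upper semicontinuous Banach bundles with a continuous associative
multiplication, covering the one of `G`, and a continuous involution. -/
structure FellBundle (G : Type u) [TopologicalSpace G] [EtaleGroupoid G] where
  fiber : G → Type u
  [instNormed : ∀ g, NormedAddCommGroup (fiber g)]
  [instSpace : ∀ g, NormedSpace ℂ (fiber g)]
  [instComplete : ∀ g, CompleteSpace (fiber g)]
  /-- the topology of the total space -/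
  [instTop : TopologicalSpace (BundleTotal fiber)]
  continuous_proj : Continuous (fun a : BundleTotal fiber => a.base)
  isOpenMap_proj : IsOpenMap (fun a : BundleTotal fiber => a.base)
  upperSemicontinuous_norm : UpperSemicontinuous (fun a : BundleTotal fiber => ‖a.val‖)
  /-- addition is continuous on the fibre product of the total space with itself -/
  continuous_add :
    @Continuous (Σ g, fiber g × fiber g) (BundleTotal fiber)
      (TopologicalSpace.induced
        (fun q => ((⟨q.1, q.2.1⟩ : BundleTotal fiber), (⟨q.1, q.2.2⟩ : BundleTotal fiber)))
        inferInstance) _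
      (fun q => ⟨q.1, q.2.1 + q.2.2⟩)
  continuous_smul : ∀ c : ℂ, Continuous
    (fun a : BundleTotal fiber => (⟨a.base, c • a.val⟩ : BundleTotal fiber))
  /-- elements whose norms tend to `0` while their base points tend to `x` converge to the
  zero of the fibre over `x` -/
  tendsto_zero : ∀ (l : Filter (BundleTotal fiber)) (x : G),
    Tendsto (fun a => a.base) l (𝓝 x) → Tendsto (fun a => ‖a.val‖) l (𝓝 0) →
      l ≤ 𝓝 (⟨x, 0⟩ : BundleTotal fiber)
  /-- the multiplication `fiber g × fiber h → fiber (gh)` -/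
  mul : ∀ {g h k : G}, IsMul g h k → fiber g → fiber h → fiber k
  mul_add : ∀ {g h k : G} (H : IsMul g h k) a b b', mul H a (b + b') = mul H a b + mul H a b'
  add_mul : ∀ {g h k : G} (H : IsMul g h k) a a' b, mul H (a + a') b = mul H a b + mul H a' b
  smul_mul : ∀ {g h k : G} (H : IsMul g h k) (c : ℂ) a b, mul H (c • a) b = c • mul H a b
  mul_smul : ∀ {g h k : G} (H : IsMul g h k) (c : ℂ) a b, mul H a (c • b) = c • mul H a b
  mul_assoc : ∀ {g h k gh hk ghk : G} (h₁ : IsMul g h gh) (h₂ : IsMul gh k ghk)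
    (h₃ : IsMul h k hk) (h₄ : IsMul g hk ghk) a b c,
    mul h₂ (mul h₁ a b) c = mul h₄ a (mul h₃ b c)
  norm_mul_le : ∀ {g h k : G} (H : IsMul g h k) a b, ‖mul H a b‖ ≤ ‖a‖ * ‖b‖
  continuous_mul : Continuous
    (fun p : {p : BundleTotal fiber × BundleTotal fiber // src p.1.base = rng p.2.base} =>
      (⟨EtaleGroupoid.mul p.1.1.base p.1.2.base p.2, mul ⟨p.2, rfl⟩ p.1.1.val p.1.2.val⟩ :
        BundleTotal fiber))
  /-- the involution `fiber g → fiber g⁻¹` -/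
  adj : ∀ {g k : G}, inv g = k → fiber g → fiber k
  adj_add : ∀ {g k : G} (H : inv g = k) a b, adj H (a + b) = adj H a + adj H b
  adj_smul : ∀ {g k : G} (H : inv g = k) (c : ℂ) a, adj H (c • a) = star c • adj H a
  adj_adj : ∀ {g k : G} (H : inv g = k) (H' : inv k = g) a, adj H' (adj H a) = a
  adj_mul : ∀ {g h gh g' h' gh' : G} (H : IsMul g h gh) (hg : inv g = g') (hh : inv h = h')
    (hgh : inv gh = gh') (H' : IsMul h' g' gh') a b,
    adj hgh (mul H a b) = mul H' (adj hh b) (adj hg a)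
  continuous_adj : Continuous
    (fun a : BundleTotal fiber => (⟨inv a.base, adj rfl a.val⟩ : BundleTotal fiber))
  norm_adj_mul_self : ∀ (g : G) (a : fiber g), ‖mul (isMul_inv' g) (adj rfl a) a‖ = ‖a‖ ^ 2
  /-- `a* a` is a positive element of the fibre `C*`-algebra over the source of `a` -/
  adj_mul_self_pos : ∀ (g : G) (a : fiber g), ∃ b : fiber (src g),
    mul (isMul_inv' g) (adj rfl a) a =
      mul (isMul_unit (rng_src g)) (adj (inv_of_rng (rng_src g)) b) b

attribute [instance] FellBundle.instNormed FellBundle.instSpace FellBundle.instComplete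
  FellBundle.instTop

namespace FellBundle

variable {G : Type u} [TopologicalSpace G] [EtaleGroupoid G] (𝒜 : FellBundle G)

theorem mul_zero {g h k : G} (H : IsMul g h k) (a : 𝒜.fiber g) : 𝒜.mul H a 0 = 0 := by
  simpa using 𝒜.mul_smul H 0 a 0

theorem zero_mul {g h k : G} (H : IsMul g h k) (a : 𝒜.fiber h) : 𝒜.mul H 0 a = 0 := by
  simpa using 𝒜.smul_mul H 0 0 a

theorem adj_zero {g k : G} (H : inv g = k) : 𝒜.adj H (0 : 𝒜.fiber g) = 0 := by
  simpa using 𝒜.adj_smul H 0 0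

/-- The map `g ↦ (g, f g)` into the total space. -/
def tot (f : ∀ g, 𝒜.fiber g) (g : G) : BundleTotal 𝒜.fiber := ⟨g, f g⟩

variable {𝒜}

theorem continuousAt_tot_zero (g₀ : G) : ContinuousAt (𝒜.tot 0) g₀ := by
  refine 𝒜.tendsto_zero _ g₀ ?_ ?_
  · exact tendsto_map'_iff.2 tendsto_id
  · refine tendsto_map'_iff.2 ?_
    have : (fun a : BundleTotal 𝒜.fiber => ‖a.val‖) ∘ 𝒜.tot 0 = fun _ => (0 : ℝ) := by
      funext g; exact norm_zero
    rw [this]; exact tendsto_const_nhds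

theorem continuousAt_tot_add {f f' : ∀ g, 𝒜.fiber g} {g₀ : G}
    (hf : ContinuousAt (𝒜.tot f) g₀) (hf' : ContinuousAt (𝒜.tot f') g₀) :
    ContinuousAt (𝒜.tot (f + f')) g₀ := by
  let _ : TopologicalSpace (Σ g, 𝒜.fiber g × 𝒜.fiber g) :=
    TopologicalSpace.induced (fun q =>
      ((⟨q.1, q.2.1⟩ : BundleTotal 𝒜.fiber), (⟨q.1, q.2.2⟩ : BundleTotal 𝒜.fiber))) inferInstance
  have h1 : ContinuousAt (fun g => (⟨g, f g, f' g⟩ : Σ g, 𝒜.fiber g × 𝒜.fiber g)) g₀ := by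
    refine (Topology.IsInducing.induced _).continuousAt_iff.2 ?_
    exact hf.prodMk hf'
  exact ContinuousAt.comp (f := fun g => (⟨g, f g, f' g⟩ : Σ g, 𝒜.fiber g × 𝒜.fiber g))
    𝒜.continuous_add.continuousAt h1

theorem continuousAt_tot_sum {ι : Type*} (S : Finset ι) {f : ι → ∀ g, 𝒜.fiber g} {g₀ : G}
    (hf : ∀ i ∈ S, ContinuousAt (𝒜.tot (f i)) g₀) :
    ContinuousAt (𝒜.tot (∑ i ∈ S, f i)) g₀ := by
  classical
  induction S using Finset.induction_on with
  | empty => simpa using continuousAt_tot_zero g₀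
  | insert a S ha ih =>
    rw [Finset.sum_insert ha]
    exact continuousAt_tot_add (hf _ (Finset.mem_insert_self _ _))
      (ih fun i hi => hf i (Finset.mem_insert_of_mem hi))

theorem continuous_tot_smul {f : ∀ g, 𝒜.fiber g} (c : ℂ) (hf : Continuous (𝒜.tot f)) :
    Continuous (𝒜.tot (c • f)) := (𝒜.continuous_smul c).comp hf

theorem mk_mul_eq {g h k : G} (H : IsMul g h k) (hc : src g = rng h) (a : 𝒜.fiber g)
    (b : 𝒜.fiber h) : (⟨k, 𝒜.mul H a b⟩ : BundleTotal 𝒜.fiber) =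
      ⟨EtaleGroupoid.mul g h hc, 𝒜.mul ⟨hc, rfl⟩ a b⟩ := by
  obtain ⟨_, rfl⟩ := H; rfl

/-- Products of continuous maps into the total space are continuous. -/
theorem continuousAt_mul {X : Type*} [TopologicalSpace X] {α β γ : X → G} {x₀ : X}
    {a : ∀ x, 𝒜.fiber (α x)} {b : ∀ x, 𝒜.fiber (β x)} {c : ∀ x, 𝒜.fiber (γ x)}
    (ha : ContinuousAt (fun x => (⟨α x, a x⟩ : BundleTotal 𝒜.fiber)) x₀)
    (hb : ContinuousAt (fun x => (⟨β x, b x⟩ : BundleTotal 𝒜.fiber)) x₀)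
    (H : ∀ᶠ x in 𝓝 x₀, ∃ h : IsMul (α x) (β x) (γ x), c x = 𝒜.mul h (a x) (b x)) :
    ContinuousAt (fun x => (⟨γ x, c x⟩ : BundleTotal 𝒜.fiber)) x₀ := by
  classical
  let T := BundleTotal 𝒜.fiber
  let m : T × T → T := fun p => if h : src p.1.base = rng p.2.base then
    ⟨EtaleGroupoid.mul p.1.base p.2.base h, 𝒜.mul ⟨h, rfl⟩ p.1.val p.2.val⟩ else p.1
  have hm : ContinuousOn m {p : T × T | src p.1.base = rng p.2.base} := by
    rw [continuousOn_iff_continuous_domRestrict]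
    refine 𝒜.continuous_mul.congr fun p => ?_
    have : src p.1.1.base = rng p.1.2.base := p.2
    simp only [Set.domRestrict_apply, m, dif_pos this]
  have hev : ∀ᶠ x in 𝓝 x₀, (⟨γ x, c x⟩ : T) = m (⟨α x, a x⟩, ⟨β x, b x⟩) := by
    filter_upwards [H] with x hx
    obtain ⟨⟨h, h'⟩, hc⟩ := hx
    simp only [m, dif_pos h]
    rw [hc]
    exact mk_mul_eq ⟨h, h'⟩ h _ _
  have hev' : ∀ᶠ x in 𝓝 x₀, ((⟨α x, a x⟩, ⟨β x, b x⟩) : T × T) ∈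
      {p : T × T | src p.1.base = rng p.2.base} := by
    filter_upwards [H] with x hx
    exact hx.choose.choose
  refine ContinuousAt.congr (f := fun x => m (⟨α x, a x⟩, ⟨β x, b x⟩)) ?_
    (hev.mono fun x hx => hx.symm)
  have h0 := hm _ hev'.self_of_nhds
  exact Tendsto.comp h0 (tendsto_nhdsWithin_iff.2 ⟨ha.prodMk hb, hev'⟩)

variable (𝒜) in
/-- The space `Γ_c(𝒜)` of continuous compactly supported sections, as a subspace of the space of
all sections. -/
def sections : Submodule ℂ (∀ g, 𝒜.fiber g) where
  carrier := {f | Continuous (𝒜.tot f) ∧ ∃ K : Set G, IsCompact K ∧ ∀ g ∉ K, f g = 0}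
  zero_mem' := ⟨continuous_iff_continuousAt.2 continuousAt_tot_zero, ∅, isCompact_empty, by simp⟩
  add_mem' := by
    rintro f f' ⟨hf, K, hK, hfK⟩ ⟨hf', K', hK', hfK'⟩
    refine ⟨continuous_iff_continuousAt.2 fun g => continuousAt_tot_add hf.continuousAt
      hf'.continuousAt, K ∪ K', hK.union hK', fun g hg => ?_⟩
    simp only [Set.mem_union, not_or] at hg
    simp [hfK g hg.1, hfK' g hg.2]
  smul_mem' := by
    rintro c f ⟨hf, K, hK, hfK⟩
    exact ⟨continuous_tot_smul c hf, K, hK, fun g hg => by simp [hfK g hg]⟩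

variable (𝒜) in
/-- `Γ_c(𝒜)`, the space of continuous compactly supported sections. -/
def Γc : Type u := ↥𝒜.sections

instance : AddCommGroup 𝒜.Γc := inferInstanceAs (AddCommGroup ↥𝒜.sections)
instance : Module ℂ 𝒜.Γc := inferInstanceAs (Module ℂ ↥𝒜.sections)
instance : CoeFun 𝒜.Γc (fun _ => ∀ g, 𝒜.fiber g) := ⟨fun f => f.1⟩

namespace Γc

@[ext] theorem ext {f f' : 𝒜.Γc} (h : ∀ g, f g = f' g) : f = f' := Subtype.ext (funext h)
@[simp] theorem add_apply (f f' : 𝒜.Γc) (g : G) : (f + f') g = f g + f' g := rfl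
@[simp] theorem zero_apply (g : G) : (0 : 𝒜.Γc) g = 0 := rfl
@[simp] theorem smul_apply (c : ℂ) (f : 𝒜.Γc) (g : G) : (c • f) g = c • f g := rfl
theorem continuous (f : 𝒜.Γc) : Continuous (𝒜.tot f) := f.2.1

end Γc

/-- The pairs `(h, k)` with `h k = g`. -/
def Factor (g : G) : Type u := {p : G × G // IsMul p.1 p.2 g}

/-- The terms of the convolution sum. -/
def convTerm (f₁ f₂ : ∀ g, 𝒜.fiber g) (g : G) (p : Factor g) : 𝒜.fiber g :=
  𝒜.mul p.2 (f₁ p.1.1) (f₂ p.1.2)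

/-- Convolution: `(f₁ * f₂)(g)` is the sum of `f₁(h) f₂(k)` over all `(h, k)` with `h k = g`,
that is, over all `h` with `rng h = rng g` and `k = h⁻¹ g`. -/
noncomputable def convFun (f₁ f₂ : ∀ g, 𝒜.fiber g) (g : G) : 𝒜.fiber g :=
  ∑ᶠ p : Factor g, convTerm f₁ f₂ g p

theorem factor_ext {g : G} {p q : Factor g} (h : p.1.1 = q.1.1) : p = q := by
  refine Subtype.ext (Prod.ext h ?_)
  have hq := q.2
  rw [← h] at hq
  exact p.2.right_unique hq

theorem finite_left (f : 𝒜.Γc) (g : G) : {p : Factor g | f p.1.1 ≠ 0}.Finite := by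
  obtain ⟨K, hK, hfK⟩ := f.2.2
  obtain ⟨M, hM⟩ := exists_bound_rng hK
  refine Set.Finite.of_injOn (f := fun p : Factor g => p.1.1)
    (t := {h | h ∈ K ∧ rng h = rng g}) ?_ ?_ (hM (rng g)).1
  · intro p hp
    refine ⟨?_, p.2.rng_eq.symm⟩
    by_contra hh
    exact hp (hfK _ hh)
  · intro p _ q _ h
    exact factor_ext h

theorem finite_support_convTerm (f₁ : 𝒜.Γc) (f₂ : ∀ g, 𝒜.fiber g) (g : G) :
    (Function.support (convTerm (𝒜 := 𝒜) f₁ f₂ g)).Finite := by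
  refine (finite_left f₁ g).subset fun p hp h => hp ?_
  rw [convTerm, h, 𝒜.zero_mul]

theorem convTerm_eq {f₁ f₂ : ∀ g, 𝒜.fiber g} {g h k : G} (p : Factor g) (H : IsMul h k g)
    (hp : p.1.1 = h) : convTerm f₁ f₂ g p = 𝒜.mul H (f₁ h) (f₂ k) := by
  obtain rfl : p = ⟨(h, k), H⟩ := factor_ext hp
  rfl

/-- A factorisation of `g` from its first member. -/
def Factor.mk' {g : G} (h : G) (e : rng h = rng g) : Factor g :=
  ⟨(h, EtaleGroupoid.mul (inv h) g (by rw [src_inv, e])), by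
    have : IsMul (inv h) g (EtaleGroupoid.mul (inv h) g (by rw [src_inv, e])) := ⟨_, rfl⟩
    have := this.inv_left
    rwa [EtaleGroupoid.inv_inv] at this⟩

theorem continuous_convFun [T2Space G] (f₁ f₂ : 𝒜.Γc) : Continuous (𝒜.tot (convFun f₁ f₂)) := by
  classical
  rw [continuous_iff_continuousAt]
  intro g₀
  obtain ⟨K, hK, hfK⟩ := f₁.2.2
  obtain ⟨M, hM⟩ := exists_bound_rng hK
  choose e hxe he using isLocalHomeomorph_rng (G := G)
  let S : Finset G := (hM (rng g₀)).1.toFinset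
  have hS : ∀ h, h ∈ S ↔ h ∈ K ∧ rng h = rng g₀ := by simp [S]
  -- the local sections of the range map
  let σ : G → G → G := fun i g => (e i).symm ⟨rng g, rng_rng g⟩
  have hrg : Continuous (fun g : G => (⟨rng g, rng_rng g⟩ : {x : G // rng x = x})) :=
    isLocalHomeomorph_rng.continuous
  have htgt : ∀ i ∈ S, (⟨rng g₀, rng_rng g₀⟩ : {x : G // rng x = x}) ∈ (e i).target := by
    intro i hi
    have h1 : (⟨rng g₀, rng_rng g₀⟩ : {x : G // rng x = x}) = e i i := by
      rw [← he]; exact Subtype.ext ((hS i).1 hi).2.symm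
    rw [h1]; exact (e i).map_source (hxe i)
  have hσ0 : ∀ i ∈ S, σ i g₀ = i := by
    intro i hi
    have h1 : (⟨rng g₀, rng_rng g₀⟩ : {x : G // rng x = x}) = e i i := by
      rw [← he]; exact Subtype.ext ((hS i).1 hi).2.symm
    simp only [σ]; rw [h1]; exact (e i).left_inv (hxe i)
  have hσc : ∀ i ∈ S, ContinuousAt (σ i) g₀ := fun i hi =>
    ContinuousAt.comp (f := fun g : G => (⟨rng g, rng_rng g⟩ : {x : G // rng x = x}))
      ((e i).symm.continuousAt (htgt i hi)) hrg.continuousAt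
  have hσr : ∀ᶠ g in 𝓝 g₀, ∀ i ∈ S, rng (σ i g) = rng g := by
    rw [Filter.eventually_all_finset]
    intro i hi
    have : ∀ᶠ g in 𝓝 g₀, (⟨rng g, rng_rng g⟩ : {x : G // rng x = x}) ∈ (e i).target :=
      hrg.continuousAt.eventually ((e i).open_target.mem_nhds (htgt i hi))
    filter_upwards [this] with g hg
    have h2 := (e i).right_inv hg
    rw [← he] at h2
    exact congrArg Subtype.val h2
  have hσinj : ∀ᶠ g in 𝓝 g₀, ∀ i ∈ S, ∀ j ∈ S, i ≠ j → σ i g ≠ σ j g := by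
    rw [Filter.eventually_all_finset]
    intro i hi
    rw [Filter.eventually_all_finset]
    intro j hj
    by_cases hij : i = j
    · simp [hij]
    · have h1 : σ i g₀ ≠ σ j g₀ := by rw [hσ0 i hi, hσ0 j hj]; exact hij
      filter_upwards [((hσc i hi).ne_iff_eventually_ne (hσc j hj)).1 h1] with g hg _
      exact hg
  have hcov : ∀ᶠ g in 𝓝 g₀, ∀ h ∈ K, rng h = rng g → ∃ i ∈ S, h = σ i g := by
    let U : Set G := ⋃ i ∈ S, (e i).source
    have hU : IsOpen U := isOpen_biUnion fun i _ => (e i).open_source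
    have hC : IsCompact (rng '' (K \ U)) := (hK.diff hU).image continuous_rng
    have hg : rng g₀ ∉ rng '' (K \ U) := by
      rintro ⟨h, ⟨hhK, hhU⟩, hh⟩
      exact hhU (Set.mem_biUnion ((hS h).2 ⟨hhK, hh⟩) (hxe h))
    have := continuous_rng.continuousAt.eventually (hC.isClosed.isOpen_compl.mem_nhds hg)
    filter_upwards [this] with g hg h hhK hh
    have hhU : h ∈ U := by
      by_contra hne
      exact hg ⟨h, ⟨hhK, hne⟩, hh⟩
    simp only [U, Set.mem_iUnion] at hhU
    obtain ⟨i, hi, hhi⟩ := hhU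
    refine ⟨i, hi, ?_⟩
    have h3 := (e i).left_inv hhi
    rw [← he] at h3
    simp only [σ, ← hh]
    exact h3.symm
  let τ : G → ∀ g, 𝒜.fiber g := fun i g =>
    if hr : rng (σ i g) = rng g then convTerm f₁ f₂ g (Factor.mk' (σ i g) hr) else 0
  have hτ : ∀ i ∈ S, ContinuousAt (𝒜.tot (τ i)) g₀ := by
    intro i hi
    let β : G → G := fun g => if hr : rng (σ i g) = rng g then
        (Factor.mk' (σ i g) hr).1.2 else g
    have hβ : ∀ᶠ g in 𝓝 g₀, IsMul (σ i g) (β g) g := by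
      filter_upwards [hσr] with g hg
      have h1 := hg i hi
      simp only [β, dif_pos h1]
      exact (Factor.mk' (σ i g) h1).2
    have hd : ContinuousAt β g₀ :=
      continuousAt_isMul (ContinuousAt.comp EtaleGroupoid.continuous_inv.continuousAt (hσc i hi)) continuousAt_id
        (hβ.mono fun g hg => hg.inv_left)
    refine continuousAt_mul (α := σ i) (a := fun g => f₁ (σ i g)) (β := β)
      (b := fun g => f₂ (β g)) ?_ ?_ ?_
    · exact f₁.continuous.continuousAt.comp (hσc i hi)
    · exact f₂.continuous.continuousAt.comp hd
    · filter_upwards [hσr, hβ] with g hg hg'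
      have h1 := hg i hi
      simp only [τ, dif_pos h1]
      exact ⟨hg', convTerm_eq _ hg' rfl⟩
  refine (continuousAt_tot_sum S hτ).congr ?_
  filter_upwards [hσr, hσinj, hcov] with g h1 h2 h3
  simp only [tot, BundleTotal.mk.injEq, heq_eq_eq, true_and, Finset.sum_apply]
  rw [convFun]
  have hsub : Function.support (convTerm (𝒜 := 𝒜) f₁ f₂ g) ⊆
      ((S.attach.image fun i => Factor.mk' (σ i.1 g) (h1 i.1 i.2) : Finset (Factor g)) :
        Set (Factor g)) := by
    intro p hp
    have hpK : p.1.1 ∈ K := by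
      by_contra hh
      exact hp (by simp [convTerm, hfK _ hh, 𝒜.zero_mul])
    obtain ⟨i, hi, hpi⟩ := h3 p.1.1 hpK p.2.rng_eq.symm
    simp only [Finset.coe_image, Set.mem_image]
    exact ⟨⟨i, hi⟩, by simp, factor_ext hpi.symm⟩
  rw [finsum_eq_sum_of_support_subset _ hsub, Finset.sum_image, ← Finset.sum_attach S]
  · refine Finset.sum_congr rfl fun i _ => ?_
    simp only [τ, dif_pos (h1 i.1 i.2)]
  · intro i _ j _ hij
    by_contra hne
    exact h2 i.1 i.2 j.1 j.2 (fun h => hne (Subtype.ext h))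
      (congrArg (fun p : Factor g => p.1.1) hij)

theorem finsum_sigma {ι : Type*} {β : ι → Type*} {M : Type*} [AddCommMonoid M]
    (f : (Σ i, β i) → M) (hf : (Function.support f).Finite) :
    ∑ᶠ x, f x = ∑ᶠ i, ∑ᶠ j, f ⟨i, j⟩ := by
  classical
  let S := hf.toFinset
  let J : ∀ i, Finset (β i) := fun i => S.preimage (Sigma.mk i)
    (fun a _ b _ h => sigma_mk_injective h)
  have h1 : ∀ i, ∑ᶠ j, f ⟨i, j⟩ = ∑ j ∈ J i, f ⟨i, j⟩ := fun i =>
    finsum_eq_sum_of_support_subset _ fun j hj =>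
      Finset.mem_coe.2 (Finset.mem_preimage.2 (hf.mem_toFinset.2 hj))
  have h2 : (Function.support fun i => ∑ᶠ j, f ⟨i, j⟩) ⊆ (S.image Sigma.fst : Finset ι) := by
    intro i hi
    rw [Function.mem_support, h1] at hi
    obtain ⟨j, hj, _⟩ := Finset.exists_ne_zero_of_sum_ne_zero hi
    simp only [Finset.coe_image, Set.mem_image]
    exact ⟨⟨i, j⟩, Finset.mem_preimage.1 hj, rfl⟩
  rw [finsum_eq_sum_of_support_subset _ h2, Finset.sum_congr rfl fun i _ => h1 i,
    Finset.sum_sigma']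
  refine finsum_eq_sum_of_support_subset _ fun x hx => ?_
  have hxS : x ∈ S := by simpa [S] using hx
  simp only [Finset.coe_sigma, Set.mem_sigma_iff, Finset.mem_coe]
  exact ⟨Finset.mem_image_of_mem _ hxS, Finset.mem_preimage.2 hxS⟩

/-- Multiplication in the fibres, as an additive map in the first variable. -/
def mulHomLeft {g h k : G} (H : IsMul g h k) (b : 𝒜.fiber h) : 𝒜.fiber g →+ 𝒜.fiber k where
  toFun a := 𝒜.mul H a b
  map_zero' := 𝒜.zero_mul H b
  map_add' a a' := 𝒜.add_mul H a a' b

/-- Multiplication in the fibres, as an additive map in the second variable. -/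
def mulHomRight {g h k : G} (H : IsMul g h k) (a : 𝒜.fiber g) : 𝒜.fiber h →+ 𝒜.fiber k where
  toFun b := 𝒜.mul H a b
  map_zero' := 𝒜.mul_zero H a
  map_add' b b' := 𝒜.mul_add H a b b'

/-- The involution of the fibres as an additive map. -/
def adjHom {g k : G} (H : inv g = k) : 𝒜.fiber g →+ 𝒜.fiber k where
  toFun a := 𝒜.adj H a
  map_zero' := 𝒜.adj_zero H
  map_add' a b := 𝒜.adj_add H a b

/-- The two ways of splitting a factorisation in three members. -/
def factorAssoc (g : G) :
    (Σ p : Factor g, Factor p.1.1) ≃ (Σ p : Factor g, Factor p.1.2) where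
  toFun x :=
    have hc : src x.2.1.2 = rng x.1.1.2 := by rw [← x.2.2.src_eq]; exact x.1.2.choose
    have hm : IsMul x.2.1.2 x.1.1.2 (EtaleGroupoid.mul _ _ hc) := ⟨hc, rfl⟩
    ⟨⟨(x.2.1.1, EtaleGroupoid.mul _ _ hc), (IsMul.assoc x.2.2 hm).1 x.1.2⟩,
      ⟨(x.2.1.2, x.1.1.2), hm⟩⟩
  invFun x :=
    have hc : src x.1.1.1 = rng x.2.1.1 := by rw [← x.2.2.rng_eq]; exact x.1.2.choose
    have hm : IsMul x.1.1.1 x.2.1.1 (EtaleGroupoid.mul _ _ hc) := ⟨hc, rfl⟩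
    ⟨⟨(EtaleGroupoid.mul _ _ hc, x.2.1.2), (IsMul.assoc hm x.2.2).2 x.1.2⟩,
      ⟨(x.1.1.1, x.2.1.1), hm⟩⟩
  left_inv := by
    rintro ⟨⟨⟨ab, c⟩, h⟩, ⟨⟨a, b⟩, hm⟩⟩
    have hm' : IsMul a b ab := hm
    obtain ⟨hc, e⟩ := hm'
    subst e; rfl
  right_inv := by
    rintro ⟨⟨⟨a, bc⟩, h⟩, ⟨⟨b, c⟩, hm⟩⟩
    have hm' : IsMul b c bc := hm
    obtain ⟨hc, e⟩ := hm'
    subst e; rfl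

/-- Inverting a factorisation. -/
def factorInv (g : G) : Factor g ≃ Factor (inv g) where
  toFun p := ⟨(inv p.1.2, inv p.1.1), p.2.inv⟩
  invFun p := ⟨(inv p.1.2, inv p.1.1), by have := p.2.inv; rwa [EtaleGroupoid.inv_inv] at this⟩
  left_inv p := factor_ext (EtaleGroupoid.inv_inv _)
  right_inv p := factor_ext (EtaleGroupoid.inv_inv _)

theorem adj_congr (f : ∀ g, 𝒜.fiber g) {i j z : G} (hi : inv i = z) (hj : inv j = z)
    (h : i = j) : 𝒜.adj hi (f i) = 𝒜.adj hj (f j) := by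
  subst h; rfl

/-- The involution of sections: `f*(g) = f(g⁻¹)*`. -/
def starFun (f : ∀ g, 𝒜.fiber g) (g : G) : 𝒜.fiber g := 𝒜.adj (EtaleGroupoid.inv_inv g) (f (inv g))

theorem mk_adj_eq {g k : G} (H : inv g = k) (a : 𝒜.fiber g) :
    (⟨k, 𝒜.adj H a⟩ : BundleTotal 𝒜.fiber) = ⟨inv g, 𝒜.adj rfl a⟩ := by
  subst H; rfl

instance : Star 𝒜.Γc where
  star f := ⟨starFun f, by
    have h : 𝒜.tot (starFun f) = fun g => (fun a : BundleTotal 𝒜.fiber =>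
        (⟨inv a.base, 𝒜.adj rfl a.val⟩ : BundleTotal 𝒜.fiber)) (𝒜.tot f (inv g)) := by
      funext g; exact mk_adj_eq _ _
    rw [h]
    exact 𝒜.continuous_adj.comp (f.continuous.comp EtaleGroupoid.continuous_inv), by
    obtain ⟨K, hK, hf⟩ := f.2.2
    refine ⟨inv '' K, hK.image EtaleGroupoid.continuous_inv, fun g hg => ?_⟩
    have : inv g ∉ K := fun h => hg ⟨_, h, EtaleGroupoid.inv_inv g⟩
    simp [starFun, hf _ this, 𝒜.adj_zero]⟩

theorem star_apply (f : 𝒜.Γc) (g : G) :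
    (star f) g = 𝒜.adj (EtaleGroupoid.inv_inv g) (f (inv g)) := rfl

/-- The fibre of the source map. -/
def SrcFiber (x : G) : Type u := {k : G // src k = x}

theorem SrcFiber.isMul {x : G} (k : SrcFiber x) : IsMul (inv k.1) k.1 x := by
  have := isMul_inv' k.1
  rwa [k.2] at this

theorem SrcFiber.isMul_right {x : G} (k : SrcFiber x) : IsMul k.1 x k.1 := by
  have := isMul_src k.1
  rwa [k.2] at this

/-- Factorisations of a unit. -/
def factorUnit {x : G} (hx : rng x = x) : SrcFiber x ≃ Factor x where
  toFun k := ⟨(inv k.1, k.1), k.isMul⟩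
  invFun p := ⟨p.1.2, by rw [← p.2.src_eq, src_of_rng hx]⟩
  left_inv _ := rfl
  right_inv p := factor_ext (by
    have h1 := p.2.inv_right
    have h2 := isMul_rng (inv p.1.2)
    rw [rng_inv, ← p.2.src_eq, src_of_rng hx] at h2
    exact h2.unique h1)

/-- The term `ξ(k)* η(k)`. -/
def ipTerm {x : G} (ξ η : ∀ g, 𝒜.fiber g) (k : SrcFiber x) : 𝒜.fiber x :=
  𝒜.mul k.isMul (𝒜.adj rfl (ξ k.1)) (η k.1)

theorem finite_srcFiber {x : G} (f : 𝒜.Γc) : {k : SrcFiber x | f k.1 ≠ 0}.Finite := by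
  obtain ⟨K, hK, hf⟩ := f.2.2
  obtain ⟨M, hM⟩ := exists_bound_rng (hK.image EtaleGroupoid.continuous_inv)
  refine Set.Finite.of_injOn (f := fun k : SrcFiber x => inv k.1)
    (t := {h | h ∈ inv '' K ∧ rng h = x}) ?_ ?_ (hM x).1
  · intro k hk
    exact ⟨⟨k.1, by by_contra h; exact hk (hf _ h), rfl⟩, (rng_inv k.1).trans k.2⟩
  · intro k _ k' _ h
    have h' := congrArg inv h
    simp only [EtaleGroupoid.inv_inv] at h'
    exact Subtype.ext h'

theorem exists_norm_le (f : 𝒜.Γc) : ∃ C : ℝ, 0 ≤ C ∧ ∀ g, ‖f g‖ ≤ C := by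
  obtain ⟨K, hK, hf⟩ := f.2.2
  have h1 : UpperSemicontinuousOn (fun g => ‖f g‖) K :=
    (UpperSemicontinuous.comp 𝒜.upperSemicontinuous_norm f.continuous).upperSemicontinuousOn K
  obtain ⟨C, hC⟩ := h1.bddAbove_of_isCompact hK
  refine ⟨max C 0, le_max_right _ _, fun g => ?_⟩
  by_cases hg : g ∈ K
  · exact (hC ⟨g, hg, rfl⟩).trans (le_max_left _ _)
  · rw [hf g hg, norm_zero]; exact le_max_right _ _

theorem norm_adj {g k : G} (H : inv g = k) (a : 𝒜.fiber g) : ‖𝒜.adj H a‖ = ‖a‖ := by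
  have key : ∀ {g : G} (a : 𝒜.fiber g), ‖a‖ ≤ ‖𝒜.adj rfl a‖ := by
    intro g a
    have h := 𝒜.norm_mul_le (isMul_inv' g) (𝒜.adj rfl a) a
    rw [𝒜.norm_adj_mul_self, sq] at h
    rcases (norm_nonneg a).eq_or_lt with h0 | h0
    · rw [← h0]; exact norm_nonneg _
    · exact le_of_mul_le_mul_right h h0
  have key' : ∀ {g k : G} (H : inv g = k) (a : 𝒜.fiber g), ‖a‖ ≤ ‖𝒜.adj H a‖ := by
    rintro g k rfl a; exact key a
  refine le_antisymm ?_ (key' H a)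
  have := key' (show inv k = g by rw [← H, EtaleGroupoid.inv_inv]) (𝒜.adj H a)
  rwa [𝒜.adj_adj] at this

/-- The auxiliary column norm `sup_x ∑_{src k = x} ‖f(k)‖`. -/
noncomputable def colNorm (f : 𝒜.Γc) : ENNReal := ⨆ x : G, ∑' k : SrcFiber x, ‖f k.1‖ₑ

theorem tsum_le_colNorm (f : 𝒜.Γc) (x : G) : ∑' k : SrcFiber x, ‖f k.1‖ₑ ≤ colNorm f :=
  le_iSup (fun x : G => ∑' k : SrcFiber x, ‖f k.1‖ₑ) x

theorem colNorm_ne_top (f : 𝒜.Γc) : colNorm f ≠ ⊤ := by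
  classical
  obtain ⟨C, hC0, hC⟩ := exists_norm_le f
  obtain ⟨K, hK, hf⟩ := f.2.2
  obtain ⟨M, hM⟩ := exists_bound_rng (hK.image EtaleGroupoid.continuous_inv)
  refine ne_top_of_le_ne_top (b := (M : ENNReal) * ENNReal.ofReal C)
    (ENNReal.mul_ne_top (ENNReal.natCast_ne_top M) ENNReal.ofReal_ne_top) (iSup_le fun x => ?_)
  have h1 : ∑' k : SrcFiber x, ‖f k.1‖ₑ = ∑ k ∈ (finite_srcFiber (x := x) f).toFinset, ‖f k.1‖ₑ := by
    refine tsum_eq_sum fun k hk => ?_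
    have : f k.1 = 0 := by
      by_contra h
      exact hk ((Set.Finite.mem_toFinset _).2 h)
    rw [this, enorm_zero]
  have hcard : (finite_srcFiber (x := x) f).toFinset.card ≤ M := by
    rw [← Set.ncard_coe_finset]
    refine le_trans ?_ (hM x).2
    refine Set.ncard_le_ncard_of_injOn (fun k : SrcFiber x => inv k.1) ?_ ?_ (hM x).1
    · intro k hk
      have hk' : f k.1 ≠ 0 := by simpa using hk
      exact ⟨⟨k.1, by by_contra h; exact hk' (hf _ h), rfl⟩, (rng_inv k.1).trans k.2⟩
    · intro k _ k' _ h
      have h' := congrArg inv h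
      simp only [EtaleGroupoid.inv_inv] at h'
      exact Subtype.ext h'
  rw [h1]
  calc ∑ k ∈ (finite_srcFiber (x := x) f).toFinset, ‖f k.1‖ₑ
      ≤ ∑ _k ∈ (finite_srcFiber (x := x) f).toFinset, ENNReal.ofReal C := by
        refine Finset.sum_le_sum fun k _ => ?_
        rw [← ofReal_norm]
        exact ENNReal.ofReal_le_ofReal (hC _)
    _ = ((finite_srcFiber (x := x) f).toFinset.card : ENNReal) * ENNReal.ofReal C := by
        rw [Finset.sum_const, nsmul_eq_mul]
    _ ≤ _ := by gcongr

/-- The space of bounded families `(b x)`, `b x ∈ 𝒜_x`, over the unit space, with the supremum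
norm. -/
abbrev unitBdd (𝒜 : FellBundle G) : Type u :=
  lp (fun x : unitSpace G => 𝒜.fiber x.1) ⊤

/-- The restriction of a section to the unit space. -/
def toUnit : 𝒜.Γc →ₗ[ℂ] 𝒜.unitBdd where
  toFun f := ⟨fun x => f x.1, by
    obtain ⟨C, -, hC⟩ := exists_norm_le f
    exact memℓp_infty ⟨C, by rintro _ ⟨x, rfl⟩; exact hC _⟩⟩
  map_add' _ _ := rfl
  map_smul' _ _ := rfl

/-- The pointwise involution of bounded families over the unit space. -/
def unitStar : 𝒜.unitBdd →+ 𝒜.unitBdd where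
  toFun b := ⟨fun x => 𝒜.adj (inv_of_rng x.2) (b x), memℓp_infty ⟨‖b‖, by
    rintro _ ⟨x, rfl⟩
    change ‖𝒜.adj (inv_of_rng x.2) (b x)‖ ≤ ‖b‖
    rw [norm_adj]
    exact lp.norm_apply_le_norm ENNReal.top_ne_zero b x⟩⟩
  map_zero' := by ext x; exact 𝒜.adj_zero _
  map_add' b b' := by ext x; exact 𝒜.adj_add _ _ _

theorem continuous_unitStar : Continuous (unitStar (𝒜 := 𝒜)) := by
  refine AddMonoidHomClass.continuous_of_bound unitStar 1 fun b => ?_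
  rw [one_mul]
  refine lp.norm_le_of_forall_le (norm_nonneg _) fun x => ?_
  change ‖𝒜.adj (inv_of_rng x.2) (b x)‖ ≤ ‖b‖
  rw [norm_adj]
  exact lp.norm_apply_le_norm ENNReal.top_ne_zero b x

theorem unitStar_smul (c : ℂ) (b : 𝒜.unitBdd) : unitStar (c • b) = star c • unitStar b := by
  ext x; exact 𝒜.adj_smul _ _ _

variable [T2Space G]

noncomputable instance : Mul 𝒜.Γc where
  mul f₁ f₂ := ⟨convFun f₁ f₂, continuous_convFun f₁ f₂, by
    obtain ⟨K₁, hK₁, hf₁⟩ := f₁.2.2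
    obtain ⟨K₂, hK₂, hf₂⟩ := f₂.2.2
    have hcl : IsClosed {p : G × G | src p.1 = rng p.2} :=
      isClosed_eq (continuous_src.comp continuous_fst) (continuous_rng.comp continuous_snd)
    have hcpt : IsCompact
        ((↑) ⁻¹' (K₁ ×ˢ K₂) : Set {p : G × G // src p.1 = rng p.2}) :=
      (hcl.isClosedEmbedding_subtypeVal).isCompact_preimage (hK₁.prod hK₂)
    refine ⟨_, hcpt.image EtaleGroupoid.continuous_mul, fun g hg => ?_⟩
    refine finsum_eq_zero_of_forall_eq_zero fun p => ?_
    by_cases h1 : p.1.1 ∈ K₁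
    · by_cases h2 : p.1.2 ∈ K₂
      · exact absurd ⟨⟨p.1, p.2.choose⟩, ⟨h1, h2⟩, p.2.choose_spec⟩ hg
      · simp [convTerm, hf₂ _ h2, 𝒜.mul_zero]
    · simp [convTerm, hf₁ _ h1, 𝒜.zero_mul]⟩

theorem mul_apply (f₁ f₂ : 𝒜.Γc) (g : G) : (f₁ * f₂) g = ∑ᶠ p : Factor g, convTerm f₁ f₂ g p := rfl

theorem Γc.mul_assoc' (f₁ f₂ f₃ : 𝒜.Γc) : f₁ * f₂ * f₃ = f₁ * (f₂ * f₃) := by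
  ext g
  let F : (Σ p : Factor g, Factor p.1.2) → 𝒜.fiber g := fun x =>
    𝒜.mul x.1.2 (f₁ x.1.1.1) (𝒜.mul x.2.2 (f₂ x.2.1.1) (f₃ x.2.1.2))
  have hF : (Function.support F).Finite := by
    refine Set.Finite.subset (Finset.finite_toSet ((finite_left f₁ g).toFinset.sigma
      (fun p => (finite_left f₂ p.1.2).toFinset))) ?_
    intro x hx
    simp only [Finset.coe_sigma, Set.mem_sigma_iff, Finset.mem_coe, Set.Finite.mem_toFinset,
      Set.mem_ofPred_eq]
    refine ⟨fun h => hx ?_, fun h => hx ?_⟩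
    · simp only [F, h, 𝒜.zero_mul]
    · simp only [F, h, 𝒜.zero_mul, 𝒜.mul_zero]
  have hF' : (Function.support (F ∘ factorAssoc g)).Finite := by
    rw [Function.support_comp_eq_preimage]
    exact hF.preimage (factorAssoc g).injective.injOn
  have hR : (f₁ * (f₂ * f₃)) g = ∑ᶠ x, F x := by
    rw [finsum_sigma F hF, mul_apply]
    refine finsum_congr fun p => ?_
    rw [convTerm, mul_apply]
    exact (mulHomRight p.2 (f₁ p.1.1)).map_finsum (finite_support_convTerm f₂ f₃ _)
  have hL : (f₁ * f₂ * f₃) g = ∑ᶠ x, (F ∘ factorAssoc g) x := by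
    rw [finsum_sigma _ hF', mul_apply]
    refine finsum_congr fun p => ?_
    rw [convTerm, mul_apply]
    refine ((mulHomLeft p.2 (f₃ p.1.2)).map_finsum (finite_support_convTerm f₁ f₂ _)).trans ?_
    exact finsum_congr fun q => 𝒜.mul_assoc _ _ _ _ _ _ _
  rw [hL, hR]
  exact finsum_comp_equiv (factorAssoc g)

noncomputable instance : NonUnitalRing 𝒜.Γc where
  left_distrib f f₁ f₂ := by
    ext g
    simp only [Γc.add_apply, mul_apply]
    rw [← finsum_add_distrib (finite_support_convTerm f f₁ g) (finite_support_convTerm f f₂ g)]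
    exact finsum_congr fun p => 𝒜.mul_add _ _ _ _
  right_distrib f₁ f₂ f := by
    ext g
    simp only [Γc.add_apply, mul_apply]
    rw [← finsum_add_distrib (finite_support_convTerm f₁ f g) (finite_support_convTerm f₂ f g)]
    exact finsum_congr fun p => 𝒜.add_mul _ _ _ _
  zero_mul f := by
    ext g
    simp only [mul_apply]
    exact finsum_eq_zero_of_forall_eq_zero fun p => 𝒜.zero_mul _ _
  mul_zero f := by
    ext g
    simp only [mul_apply]
    exact finsum_eq_zero_of_forall_eq_zero fun p => 𝒜.mul_zero _ _
  mul_assoc := Γc.mul_assoc'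

instance : IsScalarTower ℂ 𝒜.Γc 𝒜.Γc where
  smul_assoc c f f' := by
    ext g
    simp only [smul_eq_mul, Γc.smul_apply, mul_apply]
    rw [smul_finsum]
    exact finsum_congr fun p => 𝒜.smul_mul _ _ _ _

instance : SMulCommClass ℂ 𝒜.Γc 𝒜.Γc where
  smul_comm c f f' := by
    ext g
    simp only [smul_eq_mul, Γc.smul_apply, mul_apply]
    rw [smul_finsum]
    exact finsum_congr fun p => (𝒜.mul_smul _ _ _ _).symm

instance : StarRing 𝒜.Γc where
  star_involutive f := by
    ext g
    exact (congrArg (𝒜.adj (EtaleGroupoid.inv_inv g)) (adj_congr f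
      (EtaleGroupoid.inv_inv (inv g)) rfl (EtaleGroupoid.inv_inv g))).trans (𝒜.adj_adj _ _ _)
  star_mul f₁ f₂ := by
    ext g
    simp only [star_apply, mul_apply]
    refine ((adjHom (EtaleGroupoid.inv_inv g)).map_finsum
      (finite_support_convTerm f₁ f₂ _)).trans ?_
    rw [← finsum_comp_equiv (factorInv g)]
    refine finsum_congr fun p => ?_
    exact 𝒜.adj_mul _ _ _ _ _ _ _
  star_add f₁ f₂ := by
    ext g; exact 𝒜.adj_add _ _ _

instance : StarModule ℂ 𝒜.Γc where
  star_smul c f := by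
    ext g; exact 𝒜.adj_smul _ _ _

/-- Cauchy–Schwarz for a form with values in a `C*`-algebra. -/
theorem cauchySchwarz_aux {B E : Type*} [NonUnitalCStarAlgebra B] [PartialOrder B]
    [StarOrderedRing B] [AddCommGroup E] [Module ℂ E] (act : E → B → E) (ip : E → E → B)
    (hadd : ∀ x y z, ip x (y + z) = ip x y + ip x z) (hstar : ∀ x y, star (ip x y) = ip y x)
    (hsmul : ∀ (c : ℂ) x y, ip x (c • y) = c • ip x y)
    (hact : ∀ x y b, ip x (act y b) = ip x y * b) (hpos : ∀ x, 0 ≤ ip x x) (x y : E) :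
    ‖ip x y‖ ^ 2 ≤ ‖ip x x‖ * ‖ip y y‖ := by
  set b := ip x y with hb
  have hadd' : ∀ x y z, ip (x + y) z = ip x z + ip y z := fun x y z => by
    rw [← hstar, hadd, star_add, hstar, hstar]
  have hsmul' : ∀ (c : ℂ) x y, ip (c • x) y = star c • ip x y := fun c x y => by
    rw [← hstar, hsmul, star_smul, hstar]
  have hact' : ∀ x y b, ip (act x b) y = star b * ip x y := fun x y b => by
    rw [← hstar, hact, star_mul, hstar]
  have key : ∀ s : ℝ, 0 ≤ s → s * ‖ip x x‖ ≤ 1 → s * ‖b‖ ^ 2 ≤ ‖ip y y‖ := by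
    intro s hs hst
    have h1 := hpos (y + (-(s : ℂ)) • act x b)
    have h2 : ip (y + (-(s : ℂ)) • act x b) (y + (-(s : ℂ)) • act x b) =
        ip y y - (2 * s) • (star b * b) + s ^ 2 • (star b * ip x x * b) := by
      have e1 : ip y x = star b := (hstar x y).symm
      simp only [hadd, hadd', hsmul, hsmul', hact, hact', e1, ← hb]
      simp only [neg_smul, star_neg, RCLike.star_def, Complex.conj_ofReal,
        Complex.coe_smul, smul_neg, neg_neg, smul_smul]
      rw [two_mul, add_smul, sq]
      abel
    rw [h2] at h1
    have h3 : star b * ip x x * b ≤ ‖ip x x‖ • (star b * b) :=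
      CStarAlgebra.star_left_conjugate_le_norm_smul (hb := (hpos x).isSelfAdjoint)
    have h4 : s ^ 2 • (star b * ip x x * b) ≤ s • (star b * b) := by
      refine (smul_le_smul_of_nonneg_left h3 (sq_nonneg s)).trans ?_
      rw [smul_smul]
      refine smul_le_smul_of_nonneg_right ?_ (star_mul_self_nonneg b)
      nlinarith
    have h5 : s • (star b * b) ≤ ip y y := by
      have h6 : 0 ≤ ip y y - (2 * s) • (star b * b) + s • (star b * b) :=
        h1.trans (add_le_add_right h4 _)
      have h7 : ip y y - (2 * s) • (star b * b) + s • (star b * b) =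
          ip y y - s • (star b * b) := by
        rw [two_mul, add_smul]; abel
      rw [h7] at h6
      exact sub_nonneg.1 h6
    have h8 := CStarAlgebra.norm_le_norm_of_nonneg_of_le
      (ha := smul_nonneg hs (star_mul_self_nonneg b)) h5
    rwa [norm_smul, CStarRing.norm_star_mul_self, ← sq, Real.norm_of_nonneg hs] at h8
  rcases (norm_nonneg (ip x x)).eq_or_lt with h0 | h0
  · rw [← h0, MulZeroClass.zero_mul]
    by_contra hne
    push Not at hne
    have := key ((‖ip y y‖ + 1) / ‖b‖ ^ 2) (by positivity) (by rw [← h0]; simp)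
    rw [div_mul_cancel₀ _ hne.ne'] at this
    linarith
  · have := key (‖ip x x‖⁻¹) (by positivity) (by rw [inv_mul_cancel₀ h0.ne'])
    rw [inv_mul_le_iff₀ h0] at this
    exact this

variable (𝒜) in
/-- The fibre of a Fell bundle over a unit is a `C*`-algebra. -/
noncomputable abbrev fiberCStar {x : G} (hx : rng x = x) : NonUnitalCStarAlgebra (𝒜.fiber x) :=
  letI : Mul (𝒜.fiber x) := ⟨fun a b => 𝒜.mul (isMul_unit hx) a b⟩
  letI : Star (𝒜.fiber x) := ⟨fun a => 𝒜.adj (inv_of_rng hx) a⟩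
  { 𝒜.instNormed x, 𝒜.instSpace x, 𝒜.instComplete x with
    mul := fun a b => 𝒜.mul (isMul_unit hx) a b
    left_distrib := fun a b c => 𝒜.mul_add _ a b c
    right_distrib := fun a b c => 𝒜.add_mul _ a b c
    zero_mul := fun a => 𝒜.zero_mul _ a
    mul_zero := fun a => 𝒜.mul_zero _ a
    mul_assoc := fun a b c => 𝒜.mul_assoc _ _ _ _ a b c
    norm_mul_le := fun a b => 𝒜.norm_mul_le _ a b
    star := fun a => 𝒜.adj (inv_of_rng hx) a
    star_involutive := fun a => 𝒜.adj_adj _ _ a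
    star_mul := fun a b => 𝒜.adj_mul _ _ _ _ _ a b
    star_add := fun a b => 𝒜.adj_add _ a b
    star_smul := fun c a => 𝒜.adj_smul _ c a
    smul_assoc := fun c a b => 𝒜.smul_mul _ c a b
    smul_comm := fun c a b => (𝒜.mul_smul _ c a b).symm
    norm_mul_self_le := fun a => by
      have key : ∀ (y z : G) (hy : inv x = y) (h : IsMul y x z) (hz : z = src x) ,
          ‖𝒜.mul h (𝒜.adj hy a) a‖ = ‖a‖ ^ 2 := by
        rintro y z rfl h rfl
        exact 𝒜.norm_adj_mul_self x a
      rw [← sq, ← key x x (inv_of_rng hx) (isMul_unit hx) (src_of_rng hx).symm]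
      exact le_rfl }

theorem star_mul_apply_unit {x : G} (hx : rng x = x) (ξ η : 𝒜.Γc) :
    (star ξ * η) x = ∑ᶠ k : SrcFiber x, ipTerm ξ η k := by
  rw [mul_apply, ← finsum_comp_equiv (factorUnit hx)]
  refine finsum_congr fun k => ?_
  exact congrArg (fun a => 𝒜.mul k.isMul a (η k.1)) (adj_congr ξ _ _ (EtaleGroupoid.inv_inv k.1))

theorem cauchySchwarz (ξ η : 𝒜.Γc) {x : G} (hx : rng x = x) :
    ‖(star ξ * η) x‖ ^ 2 ≤ ‖(star ξ * ξ) x‖ * ‖(star η * η) x‖ := by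
  classical
  let _ : NonUnitalCStarAlgebra (𝒜.fiber x) := 𝒜.fiberCStar hx
  let _ : PartialOrder (𝒜.fiber x) := CStarAlgebra.spectralOrder _
  have : StarOrderedRing (𝒜.fiber x) := CStarAlgebra.spectralOrderedRing _
  let F : Finset (SrcFiber x) := ((finite_srcFiber ξ).union (finite_srcFiber η)).toFinset
  let E := ∀ k : F, 𝒜.fiber k.1.1
  let act : E → 𝒜.fiber x → E := fun u b k => 𝒜.mul k.1.isMul_right (u k) b
  let ip : E → E → 𝒜.fiber x := fun u v =>
    ∑ k : F, 𝒜.mul k.1.isMul (𝒜.adj rfl (u k)) (v k)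
  let res : 𝒜.Γc → E := fun f k => f k.1.1
  have hip : ∀ f f' : 𝒜.Γc, (∀ k, f' k ≠ 0 → ∀ h : src k = x, (⟨k, h⟩ : SrcFiber x) ∈ F) →
      (star f * f') x = ip (res f) (res f') := by
    intro f f' hf
    rw [star_mul_apply_unit hx, finsum_eq_sum_of_support_subset (s := F) _ ?_,
      ← Finset.sum_coe_sort F]
    · rfl
    · intro k hk
      refine hf k.1 (fun h => hk ?_) k.2
      simp only [ipTerm, h, 𝒜.mul_zero]
  have hξ : ∀ k, ξ k ≠ 0 → ∀ h : src k = x, (⟨k, h⟩ : SrcFiber x) ∈ F := fun k hk h =>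
    (Set.Finite.mem_toFinset _).2 (Or.inl hk)
  have hη : ∀ k, η k ≠ 0 → ∀ h : src k = x, (⟨k, h⟩ : SrcFiber x) ∈ F := fun k hk h =>
    (Set.Finite.mem_toFinset _).2 (Or.inr hk)
  rw [hip ξ η hη, hip ξ ξ hξ, hip η η hη]
  have key : ∀ (k : SrcFiber x) (a b : 𝒜.fiber k.1),
      𝒜.adj (inv_of_rng hx) (𝒜.mul k.isMul (𝒜.adj rfl a) b) = 𝒜.mul k.isMul (𝒜.adj rfl b) a := by
    intro k a b
    rw [𝒜.adj_mul k.isMul (EtaleGroupoid.inv_inv k.1) rfl (inv_of_rng hx) k.isMul, 𝒜.adj_adj]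
  refine cauchySchwarz_aux act ip ?_ ?_ ?_ ?_ ?_ _ _
  · intro u v w
    simp only [ip]
    rw [← Finset.sum_add_distrib]
    exact Finset.sum_congr rfl fun k _ => 𝒜.mul_add _ _ _ _
  · intro u v
    simp only [ip, star_sum]
    exact Finset.sum_congr rfl fun k _ => key k.1 _ _
  · intro c u v
    simp only [ip, Finset.smul_sum]
    exact Finset.sum_congr rfl fun k _ => 𝒜.mul_smul _ _ _ _
  · intro u v b
    simp only [ip, Finset.sum_mul]
    exact Finset.sum_congr rfl fun k _ => (𝒜.mul_assoc _ _ _ _ _ _ _).symm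
  · intro u
    refine Finset.sum_nonneg fun k _ => ?_
    have h1 : ∀ (z : G) (hz : src k.1.1 = z) (hz' : rng z = z) (h : IsMul (inv k.1.1) k.1.1 z),
        ∃ b : 𝒜.fiber z, 𝒜.mul h (𝒜.adj rfl (u k)) (u k) =
          𝒜.mul (isMul_unit hz') (𝒜.adj (inv_of_rng hz') b) b := by
      rintro z rfl hz' h
      exact 𝒜.adj_mul_self_pos k.1.1 (u k)
    obtain ⟨b, hb⟩ := h1 x k.1.2 hx k.1.isMul
    rw [hb]
    exact star_mul_self_nonneg b

/-- The inner product `⟨ξ, η⟩ = (ξ* η)|_{G⁰}` on `Γ_c(𝒜)`. -/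
noncomputable def ip (ξ η : 𝒜.Γc) : 𝒜.unitBdd := toUnit (star ξ * η)

theorem norm_ip_le (ξ η : 𝒜.Γc) : ‖ip ξ η‖ ^ 2 ≤ ‖ip ξ ξ‖ * ‖ip η η‖ := by
  have h : ‖ip ξ η‖ ≤ √(‖ip ξ ξ‖ * ‖ip η η‖) := by
    refine lp.norm_le_of_forall_le (Real.sqrt_nonneg _) fun x => ?_
    refine Real.le_sqrt_of_sq_le ((cauchySchwarz ξ η x.2).trans ?_)
    exact mul_le_mul (lp.norm_apply_le_norm ENNReal.top_ne_zero (ip ξ ξ) x)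
      (lp.norm_apply_le_norm ENNReal.top_ne_zero (ip η η) x) (norm_nonneg _) (norm_nonneg _)
  calc ‖ip ξ η‖ ^ 2 ≤ √(‖ip ξ ξ‖ * ‖ip η η‖) ^ 2 := by gcongr
    _ = _ := Real.sq_sqrt (by positivity)

theorem enorm_finsum_le {ι E : Type*} [NormedAddCommGroup E] (f : ι → E)
    (hf : (Function.support f).Finite) : ‖∑ᶠ i, f i‖ₑ ≤ ∑' i, ‖f i‖ₑ := by
  rw [finsum_eq_sum _ hf]
  exact (enorm_sum_le hf.toFinset f).trans (ENNReal.sum_le_tsum hf.toFinset)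

/-- Splitting an arrow with source `x` into two factors. -/
def srcFactor (x : G) : (Σ k : SrcFiber x, Factor k.1) ≃ (Σ l : SrcFiber x, SrcFiber (rng l.1)) where
  toFun y := ⟨⟨y.2.1.2, y.2.2.src_eq ▸ y.1.2⟩, ⟨y.2.1.1, y.2.2.choose⟩⟩
  invFun y := ⟨⟨EtaleGroupoid.mul y.2.1 y.1.1 y.2.2, (src_mul _ _ _).trans y.1.2⟩,
    ⟨(y.2.1, y.1.1), y.2.2, rfl⟩⟩
  left_inv := by
    rintro ⟨⟨k, hk⟩, ⟨⟨a, b⟩, hm⟩⟩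
    have hm' : IsMul a b k := hm
    obtain ⟨hc, e⟩ := hm'
    subst e; rfl
  right_inv _ := rfl

theorem colNorm_mul_le (f f' : 𝒜.Γc) : colNorm (f * f') ≤ colNorm f * colNorm f' := by
  refine iSup_le fun x => ?_
  calc ∑' k : SrcFiber x, ‖(f * f') k.1‖ₑ
      ≤ ∑' k : SrcFiber x, ∑' p : Factor k.1, ‖f p.1.1‖ₑ * ‖f' p.1.2‖ₑ := by
        refine ENNReal.tsum_le_tsum fun k => ?_
        refine (enorm_finsum_le _ (finite_support_convTerm f f' k.1)).trans ?_
        refine ENNReal.tsum_le_tsum fun p => ?_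
        rw [← ofReal_norm, ← ofReal_norm, ← ofReal_norm,
          ← ENNReal.ofReal_mul (norm_nonneg _)]
        exact ENNReal.ofReal_le_ofReal (𝒜.norm_mul_le _ _ _)
    _ = ∑' y : (Σ k : SrcFiber x, Factor k.1), ‖f y.2.1.1‖ₑ * ‖f' y.2.1.2‖ₑ :=
        (ENNReal.tsum_sigma' (fun y : (Σ k : SrcFiber x, Factor k.1) =>
          ‖f y.2.1.1‖ₑ * ‖f' y.2.1.2‖ₑ)).symm
    _ = ∑' y : (Σ l : SrcFiber x, SrcFiber (rng l.1)), ‖f y.2.1‖ₑ * ‖f' y.1.1‖ₑ :=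
        (srcFactor x).tsum_eq
          (fun y : (Σ l : SrcFiber x, SrcFiber (rng l.1)) => ‖f y.2.1‖ₑ * ‖f' y.1.1‖ₑ)
    _ = ∑' l : SrcFiber x, (∑' h : SrcFiber (rng l.1), ‖f h.1‖ₑ) * ‖f' l.1‖ₑ := by
        rw [ENNReal.tsum_sigma']
        exact tsum_congr fun l =>
          ENNReal.tsum_mul_right (f := fun h : SrcFiber (rng l.1) => ‖f h.1‖ₑ)
            (a := ‖f' l.1‖ₑ)
    _ ≤ ∑' l : SrcFiber x, colNorm f * ‖f' l.1‖ₑ :=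
        ENNReal.tsum_le_tsum fun l => mul_le_mul_left (tsum_le_colNorm f _) _
    _ = colNorm f * ∑' l : SrcFiber x, ‖f' l.1‖ₑ := ENNReal.tsum_mul_left
    _ ≤ _ := mul_le_mul_right (tsum_le_colNorm f' x) _

/-- The norm `‖ξ‖₂ = ‖⟨ξ, ξ⟩‖^{1/2}` on `Γ_c(𝒜)`. -/
noncomputable def norm₂ (ξ : 𝒜.Γc) : ℝ := √‖ip ξ ξ‖

theorem norm₂_nonneg (ξ : 𝒜.Γc) : 0 ≤ norm₂ ξ := Real.sqrt_nonneg _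

theorem sq_norm₂ (ξ : 𝒜.Γc) : norm₂ ξ ^ 2 = ‖ip ξ ξ‖ := Real.sq_sqrt (norm_nonneg _)

theorem norm_ip_le' (ξ η : 𝒜.Γc) : ‖ip ξ η‖ ≤ norm₂ ξ * norm₂ η := by
  refine le_of_sq_le_sq ?_ (mul_nonneg (norm₂_nonneg _) (norm₂_nonneg _))
  rw [mul_pow, sq_norm₂, sq_norm₂]
  exact norm_ip_le ξ η

theorem ip_add_left (ξ ξ' η : 𝒜.Γc) : ip (ξ + ξ') η = ip ξ η + ip ξ' η := by
  simp only [ip, star_add, _root_.add_mul, map_add]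

theorem ip_add_right (ξ η η' : 𝒜.Γc) : ip ξ (η + η') = ip ξ η + ip ξ η' := by
  simp only [ip, _root_.mul_add, map_add]

theorem ip_smul_left (c : ℂ) (ξ η : 𝒜.Γc) : ip (c • ξ) η = star c • ip ξ η := by
  simp only [ip, star_smul, smul_mul_assoc, map_smul]

theorem ip_smul_right (c : ℂ) (ξ η : 𝒜.Γc) : ip ξ (c • η) = c • ip ξ η := by
  simp only [ip, mul_smul_comm, map_smul]

theorem ip_mul (f ξ η : 𝒜.Γc) : ip (f * ξ) η = ip ξ (star f * η) := by
  simp only [ip, star_mul, _root_.mul_assoc]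

theorem norm₂_le_colNorm (ξ : 𝒜.Γc) : norm₂ ξ ≤ (colNorm ξ).toReal := by
  refine le_of_sq_le_sq ?_ ENNReal.toReal_nonneg
  rw [sq_norm₂]
  refine lp.norm_le_of_forall_le (sq_nonneg _) fun x => ?_
  have h1 : ‖(star ξ * ξ) x.1‖ₑ ≤ colNorm ξ ^ 2 := by
    rw [star_mul_apply_unit x.2]
    have hfin : (Function.support (ipTerm (x := x.1) ξ ξ)).Finite :=
      (finite_srcFiber ξ).subset fun k hk h => hk (by simp only [ipTerm, h, 𝒜.mul_zero])
    calc _ ≤ ∑' k : SrcFiber x.1, ‖ipTerm ξ ξ k‖ₑ := enorm_finsum_le _ hfin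
      _ ≤ ∑' k : SrcFiber x.1, colNorm ξ * ‖ξ k.1‖ₑ := by
        refine ENNReal.tsum_le_tsum fun k => ?_
        have h2 : ‖ipTerm ξ ξ k‖ₑ ≤ ‖ξ k.1‖ₑ * ‖ξ k.1‖ₑ := by
          rw [← ofReal_norm, ← ofReal_norm, ← ENNReal.ofReal_mul (norm_nonneg _)]
          refine ENNReal.ofReal_le_ofReal ?_
          refine (𝒜.norm_mul_le _ _ _).trans ?_
          rw [norm_adj]
        refine h2.trans (mul_le_mul_left ?_ _)
        exact (ENNReal.le_tsum (f := fun k : SrcFiber x.1 => ‖ξ k.1‖ₑ) k).trans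
          (tsum_le_colNorm ξ x.1)
      _ ≤ colNorm ξ * colNorm ξ := by
        rw [ENNReal.tsum_mul_left]
        exact mul_le_mul_right (tsum_le_colNorm ξ x.1) _
      _ = _ := (sq _).symm
  have h2 := ENNReal.toReal_mono (ENNReal.pow_ne_top (colNorm_ne_top ξ)) h1
  rwa [ENNReal.toReal_pow, toReal_enorm] at h2

/-- Left convolution is bounded by the column norm for self-adjoint elements. -/
theorem norm₂_mul_le_of_star_eq (T ξ : 𝒜.Γc) (hT : star T = T) :
    norm₂ (T * ξ) ≤ (colNorm T).toReal * norm₂ ξ := by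
  set c := (colNorm T).toReal with hc
  have hc0 : 0 ≤ c := ENNReal.toReal_nonneg
  -- the vectors `T^(n) ξ`
  let v : ℕ → 𝒜.Γc := fun n => (fun ζ => T * ζ)^[n] ξ
  have hv : ∀ n, v (n + 1) = T * v n := fun n => Function.iterate_succ_apply' _ _ _
  have hvN : ∀ n, norm₂ (v n) ≤ c ^ n * (colNorm ξ).toReal := by
    intro n
    have h1 : colNorm (v n) ≤ colNorm T ^ n * colNorm ξ := by
      induction n with
      | zero => simp [v]
      | succ n ih =>
        rw [hv, pow_succ']
        refine (colNorm_mul_le _ _).trans ?_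
        rw [_root_.mul_assoc]
        exact mul_le_mul_right ih _
    refine (norm₂_le_colNorm _).trans ?_
    have := ENNReal.toReal_mono (ENNReal.mul_ne_top (ENNReal.pow_ne_top (colNorm_ne_top T))
      (colNorm_ne_top ξ)) h1
    rwa [ENNReal.toReal_mul, ENNReal.toReal_pow] at this
  have hsym : ∀ m n, ip (v m) (v (n + m)) = ip ξ (v (n + m + m)) := by
    intro m
    induction m with
    | zero => intro n; rfl
    | succ m ih =>
      intro n
      rw [hv m, ip_mul, hT, ← hv]
      have := ih (n + 2)
      rw [show n + 2 + m = n + (m + 1) + 1 by ring] at this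
      rw [this]
      congr 2
      ring
  have hsq : ∀ m, norm₂ (v m) ^ 2 ≤ norm₂ ξ * norm₂ (v (2 * m)) := by
    intro m
    rw [sq_norm₂]
    have := hsym m 0
    rw [zero_add] at this
    rw [this, two_mul]
    exact norm_ip_le' _ _
  have hpow : ∀ n, norm₂ (v 1) ^ (2 ^ n) ≤ norm₂ ξ ^ (2 ^ n - 1) * norm₂ (v (2 ^ n)) := by
    intro n
    induction n with
    | zero => simp
    | succ n ih =>
      calc norm₂ (v 1) ^ (2 ^ (n + 1)) = (norm₂ (v 1) ^ (2 ^ n)) ^ 2 := by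
            rw [← pow_mul, pow_succ]
        _ ≤ (norm₂ ξ ^ (2 ^ n - 1) * norm₂ (v (2 ^ n))) ^ 2 :=
            pow_le_pow_left₀ (pow_nonneg (norm₂_nonneg _) _) ih 2
        _ = norm₂ ξ ^ ((2 ^ n - 1) * 2) * norm₂ (v (2 ^ n)) ^ 2 := by rw [mul_pow, ← pow_mul]
        _ ≤ norm₂ ξ ^ ((2 ^ n - 1) * 2) * (norm₂ ξ * norm₂ (v (2 * 2 ^ n))) :=
            mul_le_mul_of_nonneg_left (hsq _) (pow_nonneg (norm₂_nonneg _) _)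
        _ = norm₂ ξ ^ (2 ^ (n + 1) - 1) * norm₂ (v (2 ^ (n + 1))) := by
            rw [← _root_.mul_assoc, ← pow_succ, pow_succ' 2 n]
            congr 2
            have := Nat.one_le_two_pow (n := n)
            omega
  have hv1 : T * ξ = v 1 := rfl
  rw [hv1]
  by_contra hlt
  push Not at hlt
  set t := norm₂ (v 1)
  set b := norm₂ ξ
  have hb0 : 0 ≤ b := norm₂_nonneg _
  have ht0 : 0 < t := lt_of_le_of_lt (mul_nonneg hc0 hb0) hlt
  have hbpos : 0 < b := by
    rcases hb0.eq_or_lt with h | h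
    · have := hsq 1
      rw [← h, MulZeroClass.zero_mul] at this
      have : 0 < t ^ 2 := by positivity
      linarith
    · exact h
  set D := (colNorm ξ).toReal
  have hD : ∀ n, b * t ^ (2 ^ n) ≤ (c * b) ^ (2 ^ n) * D := by
    intro n
    calc b * t ^ (2 ^ n) ≤ b * (b ^ (2 ^ n - 1) * (c ^ (2 ^ n) * D)) :=
          mul_le_mul_of_nonneg_left ((hpow n).trans
            (mul_le_mul_of_nonneg_left (hvN _) (pow_nonneg hb0 _))) hb0
      _ = b ^ (2 ^ n - 1 + 1) * c ^ (2 ^ n) * D := by ring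
      _ = (c * b) ^ (2 ^ n) * D := by
          rw [Nat.sub_add_cancel Nat.one_le_two_pow, mul_pow]; ring
  have hq : c * b / t < 1 := (div_lt_one ht0).2 hlt
  have hlim : Tendsto (fun n : ℕ => (c * b / t) ^ (2 ^ n) * D) atTop (𝓝 (0 * D)) :=
    ((tendsto_pow_atTop_nhds_zero_of_lt_one (by positivity) hq).comp
      (tendsto_pow_atTop_atTop_of_one_lt (by norm_num : 1 < 2))).mul_const D
  rw [MulZeroClass.zero_mul] at hlim
  have hle : b ≤ 0 := ge_of_tendsto' hlim fun n => by
    rw [div_pow, div_mul_eq_mul_div, le_div_iff₀ (by positivity)]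
    exact hD n
  linarith

/-- Left convolution by `f` is bounded for `‖·‖₂`. -/
theorem norm₂_mul_le (f ξ : 𝒜.Γc) :
    norm₂ (f * ξ) ≤ √(colNorm (star f * f)).toReal * norm₂ ξ := by
  refine le_of_sq_le_sq ?_ (mul_nonneg (Real.sqrt_nonneg _) (norm₂_nonneg _))
  rw [mul_pow, Real.sq_sqrt ENNReal.toReal_nonneg, sq_norm₂, ip_mul]
  refine (norm_ip_le' _ _).trans ?_
  rw [← _root_.mul_assoc]
  have := norm₂_mul_le_of_star_eq (star f * f) ξ (by rw [star_mul, star_star])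
  nlinarith [norm₂_nonneg ξ]

theorem norm₂_smul (c : ℂ) (ξ : 𝒜.Γc) : norm₂ (c • ξ) = ‖c‖ * norm₂ ξ := by
  rw [norm₂, ip_smul_left, ip_smul_right, smul_smul, norm_smul, norm_mul, norm_star, ← sq,
    Real.sqrt_mul (sq_nonneg _), Real.sqrt_sq (norm_nonneg _), norm₂]

theorem norm₂_add_le (ξ η : 𝒜.Γc) : norm₂ (ξ + η) ≤ norm₂ ξ + norm₂ η := by
  refine le_of_sq_le_sq ?_ (add_nonneg (norm₂_nonneg _) (norm₂_nonneg _))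
  rw [sq_norm₂, ip_add_left, ip_add_right, ip_add_right]
  have h1 := norm_add_le (ip ξ ξ + ip ξ η) (ip η ξ + ip η η)
  have h2 := norm_add_le (ip ξ ξ) (ip ξ η)
  have h3 := norm_add_le (ip η ξ) (ip η η)
  have h4 := norm_ip_le' ξ η
  have h5 := norm_ip_le' η ξ
  have h6 := sq_norm₂ ξ
  have h7 := sq_norm₂ η
  nlinarith

theorem unitStar_ip (ξ η : 𝒜.Γc) : unitStar (ip ξ η) = ip η ξ := by
  ext x
  have h : star η * ξ = star (star ξ * η) := by rw [star_mul, star_star]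
  change 𝒜.adj (inv_of_rng x.2) ((star ξ * η) x.1) = (star η * ξ) x.1
  rw [h, star_apply]
  exact (adj_congr _ _ _ (inv_of_rng x.2)).symm

variable (𝒜) in
/-- `Γ_c(𝒜)` with the norm `‖·‖₂`. -/
def L2Pre : Type u := 𝒜.Γc

instance : AddCommGroup 𝒜.L2Pre := inferInstanceAs (AddCommGroup 𝒜.Γc)
instance : Module ℂ 𝒜.L2Pre := inferInstanceAs (Module ℂ 𝒜.Γc)
noncomputable instance : Norm 𝒜.L2Pre := ⟨fun ξ => norm₂ (𝒜 := 𝒜) ξ⟩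

theorem L2Pre.core : SeminormedSpace.Core ℂ 𝒜.L2Pre where
  norm_nonneg ξ := norm₂_nonneg (𝒜 := 𝒜) ξ
  norm_smul c ξ := norm₂_smul (𝒜 := 𝒜) c ξ
  norm_triangle ξ η := norm₂_add_le (𝒜 := 𝒜) ξ η

noncomputable instance : SeminormedAddCommGroup 𝒜.L2Pre := SeminormedAddCommGroup.ofCore L2Pre.core
noncomputable instance : NormedSpace ℂ 𝒜.L2Pre where
  norm_smul_le c ξ := (L2Pre.core.norm_smul c ξ).le

variable (𝒜) in
/-- The Hilbert module `L²(𝒜)`: the completion of `Γ_c(𝒜)` for `‖·‖₂`. -/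
abbrev L2 : Type u := UniformSpace.Completion 𝒜.L2Pre

/-- The inner product of `Γ_c(𝒜)`, as an additive map in both variables. -/
noncomputable def ipHom : 𝒜.L2Pre →+ 𝒜.L2Pre →+ 𝒜.unitBdd :=
  AddMonoidHom.mk' (fun ξ => AddMonoidHom.mk' (fun η => ip (𝒜 := 𝒜) ξ η)
    (fun _ _ => ip_add_right _ _ _)) (fun _ _ => by ext1 η; exact ip_add_left _ _ _)

theorem continuous_ipHom : Continuous (fun p : 𝒜.L2Pre × 𝒜.L2Pre => ipHom p.1 p.2) := by
  rw [continuous_iff_continuousAt]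
  rintro ⟨ξ, η⟩
  rw [ContinuousAt, tendsto_iff_norm_sub_tendsto_zero]
  have h : ∀ p : 𝒜.L2Pre × 𝒜.L2Pre, ‖ipHom p.1 p.2 - ipHom ξ η‖ ≤
      ‖p.1 - ξ‖ * ‖p.2‖ + ‖ξ‖ * ‖p.2 - η‖ := by
    intro p
    have e : ipHom p.1 p.2 - ipHom ξ η = ipHom (p.1 - ξ) p.2 + ipHom ξ (p.2 - η) := by
      simp only [map_sub, AddMonoidHom.sub_apply]; abel
    rw [e]
    exact (norm_add_le _ _).trans (add_le_add (norm_ip_le' _ _) (norm_ip_le' _ _))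
  refine squeeze_zero (fun _ => norm_nonneg _) h ?_
  have hc : Continuous (fun p : 𝒜.L2Pre × 𝒜.L2Pre =>
      ‖p.1 - ξ‖ * ‖p.2‖ + ‖ξ‖ * ‖p.2 - η‖) := by fun_prop
  have := hc.tendsto (ξ, η)
  simpa using this

/-- The inner product of `L²(𝒜)`, extended by continuity; its value at `x` is the component
over the unit `x`. -/
noncomputable def inner₂ (ξ η : 𝒜.L2) : 𝒜.unitBdd :=
  ((UniformSpace.Completion.isDenseInducing_coe (α := 𝒜.L2Pre)).prodMap
    UniformSpace.Completion.isDenseInducing_coe).extend (fun p => ipHom p.1 p.2) (ξ, η)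

theorem continuous_inner₂ : Continuous (fun p : 𝒜.L2 × 𝒜.L2 => inner₂ p.1 p.2) :=
  (UniformSpace.Completion.isDenseInducing_toCompl 𝒜.L2Pre).extend_Z_bilin
    (UniformSpace.Completion.isDenseInducing_toCompl 𝒜.L2Pre) continuous_ipHom

theorem inner₂_coe (ξ η : 𝒜.L2Pre) : inner₂ (ξ : 𝒜.L2) η = ip (𝒜 := 𝒜) ξ η :=
  ((UniformSpace.Completion.isDenseInducing_coe (α := 𝒜.L2Pre)).prodMap
    UniformSpace.Completion.isDenseInducing_coe).extend_eq continuous_ipHom (ξ, η)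

theorem continuous_inner₂' {X : Type*} [TopologicalSpace X] {f g : X → 𝒜.L2} (hf : Continuous f)
    (hg : Continuous g) : Continuous fun x => inner₂ (f x) (g x) :=
  continuous_inner₂.comp (hf.prodMk hg)

theorem norm_inner₂_le (ξ η : 𝒜.L2) : ‖inner₂ ξ η‖ ≤ ‖ξ‖ * ‖η‖ := by
  induction ξ, η using UniformSpace.Completion.induction_on₂ with
  | hp => exact isClosed_le (continuous_inner₂' continuous_fst continuous_snd).norm (by fun_prop)
  | ih ξ η =>
    rw [inner₂_coe, UniformSpace.Completion.norm_coe, UniformSpace.Completion.norm_coe]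
    exact norm_ip_le' _ _

theorem norm_inner₂_self (ξ : 𝒜.L2) : ‖inner₂ ξ ξ‖ = ‖ξ‖ ^ 2 := by
  induction ξ using UniformSpace.Completion.induction_on with
  | hp => exact isClosed_eq (continuous_inner₂' continuous_id continuous_id).norm (by fun_prop)
  | ih ξ =>
    rw [inner₂_coe, UniformSpace.Completion.norm_coe]
    exact (sq_norm₂ _).symm

theorem inner₂_add_right (ξ η ζ : 𝒜.L2) : inner₂ ξ (η + ζ) = inner₂ ξ η + inner₂ ξ ζ := by
  induction ξ, η, ζ using UniformSpace.Completion.induction_on₃ with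
  | hp =>
    exact isClosed_eq (continuous_inner₂' (by fun_prop) (by fun_prop))
      ((continuous_inner₂' (by fun_prop) (by fun_prop)).add
        (continuous_inner₂' (by fun_prop) (by fun_prop)))
  | ih ξ η ζ =>
    rw [← UniformSpace.Completion.coe_add]
    simp only [inner₂_coe]
    exact ip_add_right _ _ _

theorem inner₂_smul_right (c : ℂ) (ξ η : 𝒜.L2) : inner₂ ξ (c • η) = c • inner₂ ξ η := by
  have h1 : Continuous fun p : 𝒜.L2 × 𝒜.L2 => inner₂ p.1 (c • p.2) :=
    continuous_inner₂' continuous_fst ((continuous_const_smul c).comp continuous_snd)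
  have h2 : Continuous fun p : 𝒜.L2 × 𝒜.L2 => c • inner₂ p.1 p.2 :=
    (continuous_const_smul c).comp continuous_inner₂
  refine UniformSpace.Completion.induction_on₂ ξ η (isClosed_eq h1 h2) fun ξ η => ?_
  rw [← UniformSpace.Completion.coe_smul, inner₂_coe, inner₂_coe]
  exact ip_smul_right _ _ _

theorem unitStar_inner₂ (ξ η : 𝒜.L2) : unitStar (inner₂ ξ η) = inner₂ η ξ := by
  induction ξ, η using UniformSpace.Completion.induction_on₂ with
  | hp =>
    exact isClosed_eq (continuous_unitStar.comp (continuous_inner₂' (by fun_prop) (by fun_prop)))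
      (continuous_inner₂' (by fun_prop) (by fun_prop))
  | ih ξ η =>
    rw [inner₂_coe, inner₂_coe]
    exact unitStar_ip _ _

theorem inner₂_smul_left (c : ℂ) (ξ η : 𝒜.L2) : inner₂ (c • ξ) η = star c • inner₂ ξ η := by
  rw [← unitStar_inner₂, inner₂_smul_right, unitStar_smul, unitStar_inner₂]

theorem inner₂_add_left (ξ η ζ : 𝒜.L2) : inner₂ (ξ + η) ζ = inner₂ ξ ζ + inner₂ η ζ := by
  rw [← unitStar_inner₂, inner₂_add_right, map_add, unitStar_inner₂, unitStar_inner₂]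

theorem inner₂_sub_right (ξ η ζ : 𝒜.L2) : inner₂ ξ (η - ζ) = inner₂ ξ η - inner₂ ξ ζ := by
  have := inner₂_add_right ξ (η - ζ) ζ
  rw [sub_add_cancel] at this
  rw [this, add_sub_cancel_right]

theorem ext_inner₂ {η ζ : 𝒜.L2} (h : ∀ ξ, inner₂ ξ η = inner₂ ξ ζ) : η = ζ := by
  rw [← sub_eq_zero, ← norm_eq_zero, ← sq_eq_zero_iff, ← norm_inner₂_self, inner₂_sub_right, h,
    sub_self, norm_zero]

/-- `IsAdjointPair T S` says that `S` is an adjoint of `T` on the Hilbert module `L²(𝒜)`. -/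
def IsAdjointPair (T S : 𝒜.L2 →L[ℂ] 𝒜.L2) : Prop := ∀ ξ η, inner₂ (T ξ) η = inner₂ ξ (S η)

theorem IsAdjointPair.unique {T S S' : 𝒜.L2 →L[ℂ] 𝒜.L2} (h : IsAdjointPair T S)
    (h' : IsAdjointPair T S') : S = S' :=
  ContinuousLinearMap.ext fun η => ext_inner₂ fun ξ => by rw [← h, ← h']

theorem IsAdjointPair.symm {T S : 𝒜.L2 →L[ℂ] 𝒜.L2} (h : IsAdjointPair T S) :
    IsAdjointPair S T := fun ξ η => by
  rw [← unitStar_inner₂, ← h, unitStar_inner₂]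

theorem IsAdjointPair.norm_le {T S : 𝒜.L2 →L[ℂ] 𝒜.L2} (h : IsAdjointPair T S) : ‖S‖ ≤ ‖T‖ := by
  refine S.opNorm_le_bound (norm_nonneg _) fun ξ => ?_
  have h1 : ‖S ξ‖ ^ 2 ≤ ‖T‖ * ‖S ξ‖ * ‖ξ‖ := by
    rw [← norm_inner₂_self, ← h]
    exact (norm_inner₂_le _ _).trans (mul_le_mul_of_nonneg_right (T.le_opNorm _) (norm_nonneg _))
  rcases (norm_nonneg (S ξ)).eq_or_lt with h0 | h0
  · rw [← h0]; positivity
  · nlinarith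

theorem IsAdjointPair.norm_mul_self {T S : 𝒜.L2 →L[ℂ] 𝒜.L2} (h : IsAdjointPair T S) :
    ‖T‖ * ‖T‖ ≤ ‖S * T‖ := by
  rw [← sq]
  have h1 : ‖T‖ ≤ √‖S * T‖ := by
    refine T.opNorm_le_bound (Real.sqrt_nonneg _) fun ξ => ?_
    refine le_of_sq_le_sq ?_ (by positivity)
    rw [mul_pow, Real.sq_sqrt (norm_nonneg _), ← norm_inner₂_self, h]
    have h2 : ‖S (T ξ)‖ ≤ ‖S * T‖ * ‖ξ‖ := (S * T).le_opNorm ξ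
    have h3 := norm_inner₂_le ξ (S (T ξ))
    nlinarith [norm_nonneg ξ]
  calc ‖T‖ ^ 2 ≤ √‖S * T‖ ^ 2 := by gcongr
    _ = _ := Real.sq_sqrt (norm_nonneg _)

variable (𝒜) in
/-- The algebra `𝓛(L²(𝒜))` of adjointable operators on the Hilbert module `L²(𝒜)`. -/
def adjointables : Subalgebra ℂ (𝒜.L2 →L[ℂ] 𝒜.L2) where
  carrier := {T | ∃ S, IsAdjointPair T S}
  mul_mem' := by
    rintro T T' ⟨S, h⟩ ⟨S', h'⟩
    exact ⟨S' * S, fun ξ η => (h _ _).trans (h' _ _)⟩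
  add_mem' := by
    rintro T T' ⟨S, h⟩ ⟨S', h'⟩
    exact ⟨S + S', fun ξ η => by
      change inner₂ (T ξ + T' ξ) η = inner₂ ξ (S η + S' η)
      rw [inner₂_add_right, inner₂_add_left, h, h']⟩
  algebraMap_mem' c := ⟨star c • 1, fun ξ η => by
    change inner₂ (c • ξ) η = inner₂ ξ (star c • η)
    rw [inner₂_smul_right, inner₂_smul_left]⟩

/-- The operators `T` and `adjOp T` are adjoint to each other. -/
noncomputable def adjOp (T : 𝒜.adjointables) : 𝒜.L2 →L[ℂ] 𝒜.L2 := T.2.choose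

theorem isAdjointPair_adjOp (T : 𝒜.adjointables) : IsAdjointPair T.1 (adjOp T) := T.2.choose_spec

/-- The involution of `𝓛(L²(𝒜))` sends an operator to its adjoint. -/
noncomputable instance : Star 𝒜.adjointables where
  star T := ⟨adjOp T, T.1, (isAdjointPair_adjOp T).symm⟩

theorem isAdjointPair_star (T : 𝒜.adjointables) : IsAdjointPair T.1 (star T).1 :=
  isAdjointPair_adjOp T

theorem star_eq_of_isAdjointPair {T S : 𝒜.adjointables} (h : IsAdjointPair T.1 S.1) :
    star T = S := Subtype.ext ((isAdjointPair_star T).unique h)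

noncomputable instance : StarRing 𝒜.adjointables where
  star_involutive T := star_eq_of_isAdjointPair (isAdjointPair_star T).symm
  star_mul T S := star_eq_of_isAdjointPair fun ξ η =>
    (isAdjointPair_star T _ _).trans (isAdjointPair_star S _ _)
  star_add T S := star_eq_of_isAdjointPair fun ξ η => by
    change inner₂ (T.1 ξ + S.1 ξ) η = inner₂ ξ ((star T).1 η + (star S).1 η)
    rw [inner₂_add_right, inner₂_add_left, isAdjointPair_star T, isAdjointPair_star S]

instance : StarModule ℂ 𝒜.adjointables where
  star_smul c T := star_eq_of_isAdjointPair fun ξ η => by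
    change inner₂ (c • T.1 ξ) η = inner₂ ξ (star c • (star T).1 η)
    rw [inner₂_smul_right, inner₂_smul_left, isAdjointPair_star T]

instance : CStarRing 𝒜.adjointables where
  norm_mul_self_le T := (isAdjointPair_star T).norm_mul_self

instance : CompleteSpace 𝒜.adjointables := by
  have hcl : IsClosed (𝒜.adjointables : Set (𝒜.L2 →L[ℂ] 𝒜.L2)) := by
    refine isClosed_of_closure_subset fun T hT => ?_
    obtain ⟨u, hu, hlim⟩ := mem_closure_iff_seq_limit.1 hT
    choose S hS using hu
    have hdiff : ∀ m n, ‖S m - S n‖ ≤ ‖u m - u n‖ := fun m n =>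
      IsAdjointPair.norm_le (T := u m - u n) fun ξ η => by
        change inner₂ (u m ξ - u n ξ) η = inner₂ ξ (S m η - S n η)
        rw [inner₂_sub_right, ← hS, ← hS, ← unitStar_inner₂, inner₂_sub_right, map_sub,
          unitStar_inner₂, unitStar_inner₂]
    have hc : CauchySeq S := by
      have hcu := hlim.cauchySeq
      rw [Metric.cauchySeq_iff] at hcu ⊢
      intro ε hε
      obtain ⟨N, hN⟩ := hcu ε hε
      refine ⟨N, fun m hm n hn => lt_of_le_of_lt ?_ (hN m hm n hn)⟩
      rw [dist_eq_norm, dist_eq_norm]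
      exact hdiff m n
    obtain ⟨S', hS'⟩ := cauchySeq_tendsto_of_complete hc
    refine ⟨S', fun ξ η => ?_⟩
    have e1 : Tendsto (fun n => inner₂ (u n ξ) η) atTop (𝓝 (inner₂ (T ξ) η)) :=
      (continuous_inner₂' continuous_id continuous_const).continuousAt.tendsto.comp
        (((ContinuousLinearMap.apply ℂ 𝒜.L2 ξ).continuous.tendsto T).comp hlim)
    have e2 : Tendsto (fun n => inner₂ ξ (S n η)) atTop (𝓝 (inner₂ ξ (S' η))) :=
      (continuous_inner₂' continuous_const continuous_id).continuousAt.tendsto.comp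
        (((ContinuousLinearMap.apply ℂ 𝒜.L2 η).continuous.tendsto S').comp hS')
    refine tendsto_nhds_unique e1 (e2.congr fun n => ?_)
    exact (hS n ξ η).symm
  exact hcl.completeSpace_coe

noncomputable instance : CStarAlgebra 𝒜.adjointables where


/-- Left convolution by `f`, on `Γ_c(𝒜)` with the norm `‖·‖₂`. -/
noncomputable def lmulFun (f : 𝒜.Γc) (ξ : 𝒜.L2Pre) : 𝒜.L2Pre := Mul.mul (α := 𝒜.Γc) f ξ

theorem lmulFun_add_right (f : 𝒜.Γc) (ξ η : 𝒜.L2Pre) :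
    lmulFun f (ξ + η) = lmulFun f ξ + lmulFun f η :=
  _root_.mul_add (R := 𝒜.Γc) f ξ η

theorem lmulFun_smul_right (f : 𝒜.Γc) (c : ℂ) (ξ : 𝒜.L2Pre) :
    lmulFun f (c • ξ) = c • lmulFun f ξ :=
  mul_smul_comm (β := 𝒜.Γc) c f ξ

theorem lmulFun_add (f f' : 𝒜.Γc) (ξ : 𝒜.L2Pre) :
    lmulFun (f + f') ξ = lmulFun f ξ + lmulFun f' ξ :=
  _root_.add_mul (R := 𝒜.Γc) f f' ξ

theorem lmulFun_smul (c : ℂ) (f : 𝒜.Γc) (ξ : 𝒜.L2Pre) :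
    lmulFun (c • f) ξ = c • lmulFun f ξ :=
  smul_mul_assoc (β := 𝒜.Γc) c f ξ

theorem lmulFun_mul (f f' : 𝒜.Γc) (ξ : 𝒜.L2Pre) :
    lmulFun (f * f') ξ = lmulFun f (lmulFun f' ξ) :=
  _root_.mul_assoc (G := 𝒜.Γc) f f' ξ

/-- Left convolution by `f` on `Γ_c(𝒜)`, as a bounded operator for `‖·‖₂`. -/
noncomputable def lmulPre (f : 𝒜.Γc) : 𝒜.L2Pre →L[ℂ] 𝒜.L2Pre :=
  LinearMap.mkContinuous
    { toFun := lmulFun f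
      map_add' := lmulFun_add_right f
      map_smul' := lmulFun_smul_right f }
    (√(colNorm (star f * f)).toReal) (fun ξ => norm₂_mul_le f ξ)

/-- The extension of left convolution by `f` to `L²(𝒜)`. -/
noncomputable def lmul (f : 𝒜.Γc) : 𝒜.L2 →L[ℂ] 𝒜.L2 := (lmulPre f).completion

theorem lmul_coe (f : 𝒜.Γc) (ξ : 𝒜.L2Pre) : lmul f (ξ : 𝒜.L2) = (lmulFun f ξ : 𝒜.L2Pre) :=
  (lmulPre f).completion_apply_coe ξ

theorem isAdjointPair_lmul (f : 𝒜.Γc) : IsAdjointPair (lmul f) (lmul (star f)) := by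
  intro ξ η
  refine UniformSpace.Completion.induction_on₂ ξ η (isClosed_eq
    (continuous_inner₂' ((lmul f).continuous.comp continuous_fst) continuous_snd)
    (continuous_inner₂' continuous_fst ((lmul (star f)).continuous.comp continuous_snd)))
    fun ξ η => ?_
  rw [lmul_coe, lmul_coe, inner₂_coe, inner₂_coe]
  exact ip_mul f ξ η

theorem lmul_ext {T S : 𝒜.L2 →L[ℂ] 𝒜.L2} (h : ∀ ξ : 𝒜.L2Pre, T (ξ : 𝒜.L2) = S ξ) : T = S :=
  ContinuousLinearMap.ext fun ξ => UniformSpace.Completion.induction_on ξ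
    (isClosed_eq T.continuous S.continuous) h

theorem lmul_add (f f' : 𝒜.Γc) : lmul (f + f') = lmul f + lmul f' :=
  lmul_ext fun ξ => by
    rw [_root_.add_apply, lmul_coe, lmul_coe, lmul_coe, lmulFun_add,
      UniformSpace.Completion.coe_add]

theorem lmul_smul (c : ℂ) (f : 𝒜.Γc) : lmul (c • f) = c • lmul f :=
  lmul_ext fun ξ => by
    rw [_root_.smul_apply, lmul_coe, lmul_coe, lmulFun_smul,
      UniformSpace.Completion.coe_smul]

theorem lmul_mul (f f' : 𝒜.Γc) : lmul (f * f') = lmul f * lmul f' :=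
  lmul_ext fun ξ => by
    rw [mul_apply_eq_comp, lmul_coe, lmul_coe, lmul_coe, lmulFun_mul]

theorem lmul_zero : lmul (0 : 𝒜.Γc) = 0 := by
  have h := lmul_add (0 : 𝒜.Γc) 0
  rwa [add_zero, left_eq_add] at h

/-- `lmul f` as an element of `𝓛(L²(𝒜))`. -/
noncomputable def lmulOp (f : 𝒜.Γc) : 𝒜.adjointables := ⟨lmul f, lmul (star f), isAdjointPair_lmul f⟩

variable (𝒜) in
/-- The left regular representation of `Γ_c(𝒜)` by adjointable operators on `L²(𝒜)`. -/
noncomputable def regRep : 𝒜.Γc →⋆ₙₐ[ℂ] 𝒜.adjointables where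
  toFun := lmulOp
  map_smul' c f := Subtype.ext (lmul_smul c f)
  map_zero' := Subtype.ext lmul_zero
  map_add' f f' := Subtype.ext (lmul_add f f')
  map_mul' f f' := Subtype.ext (lmul_mul f f')
  map_star' f := (star_eq_of_isAdjointPair (T := lmulOp f) (S := lmulOp (star f))
    (isAdjointPair_lmul f)).symm

variable (𝒜) in
/-- The reduced `C*`-algebra `C*_r(𝒜)`: the operator norm closure of the range of the left
regular representation. -/
noncomputable def reducedSubalgebra : NonUnitalStarSubalgebra ℂ 𝒜.adjointables :=
  (NonUnitalStarAlgHom.range 𝒜.regRep).topologicalClosure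

variable (𝒜) in
/-- The underlying type of `C*_r(𝒜)`. -/
def Cr : Type u := ↥𝒜.reducedSubalgebra

noncomputable instance : NonUnitalCStarAlgebra 𝒜.Cr :=
  haveI : IsClosed (𝒜.reducedSubalgebra : Set 𝒜.adjointables) :=
    NonUnitalStarSubalgebra.isClosed_topologicalClosure (NonUnitalStarAlgHom.range 𝒜.regRep)
  inferInstanceAs (NonUnitalCStarAlgebra ↥𝒜.reducedSubalgebra)

theorem regRep_mem (f : 𝒜.Γc) : 𝒜.regRep f ∈ 𝒜.reducedSubalgebra :=
  NonUnitalStarSubalgebra.le_topologicalClosure (NonUnitalStarAlgHom.range 𝒜.regRep)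
    (NonUnitalStarAlgHom.mem_range_self 𝒜.regRep f)

variable (𝒜) in
/-- The canonical map `i_{𝒜,r} : Γ_c(𝒜) → C*_r(𝒜)`. -/
noncomputable def iRed : 𝒜.Γc →⋆ₙₐ[ℂ] 𝒜.Cr :=
  NonUnitalStarAlgHom.codRestrict 𝒜.regRep 𝒜.reducedSubalgebra regRep_mem

/-- The restriction map `P_𝒜 : Γ_c(𝒜) → Γ_c(𝒜⁰)`, where sections of `𝒜⁰ = 𝒜|_{G⁰}` are
identified with sections of `𝒜` that vanish outside the unit space. -/
noncomputable def restrictUnit : 𝒜.Γc →ₗ[ℂ] 𝒜.Γc := by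
  classical
  exact
  { toFun := fun f => ⟨fun g => if g ∈ unitSpace G then f g else 0, by
      rw [continuous_iff_continuousAt]
      intro g
      by_cases hg : g ∈ unitSpace G
      · refine f.continuous.continuousAt.congr ?_
        filter_upwards [isOpen_unitSpace.mem_nhds hg] with k hk
        simp only [tot, if_pos hk]
      · refine (continuousAt_tot_zero g).congr ?_
        filter_upwards [isClosed_unitSpace.isOpen_compl.mem_nhds hg] with k hk
        have hk' : k ∉ unitSpace G := hk
        simp only [tot, if_neg hk', Pi.zero_apply], by
      obtain ⟨K, hK, hf⟩ := f.2.2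
      exact ⟨K, hK, fun g hg => by simp only [hf g hg, ite_self]⟩⟩
    map_add' := fun f f' => by
      ext g
      change (if g ∈ unitSpace G then f g + f' g else 0) =
        (if g ∈ unitSpace G then f g else 0) + (if g ∈ unitSpace G then f' g else 0)
      split_ifs <;> simp
    map_smul' := fun c f => by
      ext g
      change (if g ∈ unitSpace G then c • f g else 0) = c • (if g ∈ unitSpace G then f g else 0)
      split_ifs <;> simp }

variable (𝒜) in
/-- The subspace `Γ_c(𝒜⁰)` of `Γ_c(𝒜)`: the sections that vanish outside the unit space. -/
def unitSections : Set 𝒜.Γc := {f | ∀ g ∉ unitSpace G, f g = 0}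

end FellBundle

/-- `E` is a conditional expectation of the `C*`-algebra `A` onto its `C*`-subalgebra `D`: a
contractive positive linear projection onto `D` that is `D`-bilinear. -/
structure IsConditionalExpectation {A : Type u} [NonUnitalCStarAlgebra A] (D : Set A)
    (E : A →ₗ[ℂ] A) : Prop where
  mem : ∀ a, E a ∈ D
  apply_of_mem : ∀ d ∈ D, E d = d
  norm_le : ∀ a, ‖E a‖ ≤ ‖a‖
  pos : ∀ a, ∃ b, E (star a * a) = star b * b
  map_mul_left : ∀ d ∈ D, ∀ a, E (d * a) = d * E a
  map_mul_right : ∀ d ∈ D, ∀ a, E (a * d) = E a * d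

theorem starHom_ext_of_denseRange {A B ι : Type u} [NonUnitalCStarAlgebra A]
    [NonUnitalCStarAlgebra B] {i : ι → A} (hi : DenseRange i) {φ ψ : A →⋆ₙₐ[ℂ] B}
    (h : ∀ f, φ (i f) = ψ (i f)) : φ = ψ :=
  have hc : ∀ χ : A →⋆ₙₐ[ℂ] B, Continuous χ := fun χ =>
    AddMonoidHomClass.continuous_of_bound χ 1 fun a => by
      rw [one_mul]; exact NonUnitalStarAlgHom.norm_apply_le χ a
  DFunLike.coe_injective (hi.equalizer (hc φ) (hc ψ) (funext fun f => h f))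

namespace FellBundle

variable {G : Type u} [TopologicalSpace G] [T2Space G] [EtaleGroupoid G]

/-- `(𝒜, i)` is a topological `G`-grading of `A`: the homomorphism `i : Γ_c(𝒜) → A` is injective
with dense range, and there is a conditional expectation `E` of `A` onto the closure of
`i(Γ_c(𝒜⁰))` (which is the copy of `Γ_0(𝒜⁰)` in `A`) such that `E (i f) = i (f|_{G⁰})`. -/
structure IsTopologicalGrading (𝒜 : FellBundle G) {A : Type u} [NonUnitalCStarAlgebra A]
    (i : 𝒜.Γc →⋆ₙₐ[ℂ] A) : Prop where
  injective : Function.Injective i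
  denseRange : DenseRange i
  exists_condExp : ∃ E : A →ₗ[ℂ] A,
    IsConditionalExpectation (closure (i '' 𝒜.unitSections)) E ∧
      ∀ f, E (i f) = i (restrictUnit f)

/-- Morphisms of Fell bundles over `G`. -/
@[ext]
structure Hom (𝒜 ℬ : FellBundle G) : Type u where
  toFun : ∀ g, 𝒜.fiber g →ₗ[ℂ] ℬ.fiber g
  continuous : Continuous (fun a : BundleTotal 𝒜.fiber =>
    (⟨a.base, toFun a.base a.val⟩ : BundleTotal ℬ.fiber))
  map_mul : ∀ {g h k : G} (H : IsMul g h k) a b,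
    toFun k (𝒜.mul H a b) = ℬ.mul H (toFun g a) (toFun h b)
  map_adj : ∀ {g k : G} (H : inv g = k) a, toFun k (𝒜.adj H a) = ℬ.adj H (toFun g a)

instance : Category (FellBundle G) where
  Hom := Hom
  id 𝒜 := ⟨fun _ => LinearMap.id, continuous_id, fun _ _ _ => rfl, fun _ _ => rfl⟩
  comp φ γ := ⟨fun g => (γ.toFun g).comp (φ.toFun g), γ.continuous.comp φ.continuous,
    fun H a b => by simp [φ.map_mul, γ.map_mul], fun H a => by simp [φ.map_adj, γ.map_adj]⟩

/-- The homomorphism `φ^c : Γ_c(𝒜) → Γ_c(ℬ)`, `φ^c(f) = φ ∘ f`. -/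
noncomputable def Hom.mapΓ {𝒜 ℬ : FellBundle G} (φ : 𝒜 ⟶ ℬ) : 𝒜.Γc →⋆ₙₐ[ℂ] ℬ.Γc where
  toFun f := ⟨fun g => φ.toFun g (f g), φ.continuous.comp f.continuous, by
    obtain ⟨K, hK, hf⟩ := f.2.2
    exact ⟨K, hK, fun g hg => (congrArg (φ.toFun g) (hf g hg)).trans (map_zero (φ.toFun g))⟩⟩
  map_smul' c f := by ext g; exact map_smul (φ.toFun g) c (f g)
  map_zero' := by ext g; exact map_zero (φ.toFun g)
  map_add' f f' := by ext g; exact map_add (φ.toFun g) _ _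
  map_mul' f f' := by
    ext g
    refine ((φ.toFun g).toAddMonoidHom.map_finsum (finite_support_convTerm f f' g)).trans ?_
    exact finsum_congr fun p => φ.map_mul _ _ _
  map_star' f := by ext g; exact φ.map_adj _ _

end FellBundle

open FellBundle

/-- The objects of `C^top_G`: triples `(A, 𝒜, i)` where `(𝒜, i)` is a topological `G`-grading of
the `C*`-algebra `A`. -/
structure TopGraded (G : Type u) [TopologicalSpace G] [T2Space G] [EtaleGroupoid G] where
  alg : Type u
  [instAlg : NonUnitalCStarAlgebra alg]
  bundle : FellBundle G
  i : bundle.Γc →⋆ₙₐ[ℂ] alg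
  isTopologicalGrading : IsTopologicalGrading bundle i

attribute [instance] TopGraded.instAlg

namespace TopGraded

variable {G : Type u} [TopologicalSpace G] [T2Space G] [EtaleGroupoid G]

/-- Morphisms `(ϕ, φ) : (A, 𝒜, i) → (B, ℬ, j)` of `C^top_G`. -/
@[ext]
structure Hom (X Y : TopGraded G) : Type u where
  algHom : X.alg →⋆ₙₐ[ℂ] Y.alg
  fellHom : X.bundle ⟶ Y.bundle
  comm : ∀ f, algHom (X.i f) = Y.i (Hom.mapΓ fellHom f)

/-- The category `C^top_G`. -/
instance : Category (TopGraded G) where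
  Hom := Hom
  id X := ⟨NonUnitalStarAlgHom.id ℂ X.alg, 𝟙 X.bundle, fun _ => rfl⟩
  comp φ γ := ⟨γ.algHom.comp φ.algHom, φ.fellHom ≫ γ.fellHom, fun f => by
    rw [NonUnitalStarAlgHom.comp_apply, φ.comm, γ.comm]; rfl⟩

theorem hom_ext' {X Y : TopGraded G} {φ γ : X ⟶ Y} (h₁ : ∀ a, φ.algHom a = γ.algHom a)
    (h₂ : φ.fellHom = γ.fellHom) : φ = γ :=
  Hom.ext (NonUnitalStarAlgHom.ext h₁) h₂

/-- The object `(C*_r(𝒜), 𝒜, i_{𝒜,r})`. -/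
noncomputable def reduced (𝒜 : FellBundle G) (h : IsTopologicalGrading 𝒜 𝒜.iRed) : TopGraded G where
  alg := 𝒜.Cr
  bundle := 𝒜
  i := 𝒜.iRed
  isTopologicalGrading := h

variable (G) in
/-- The gradings `(𝒜, i_{𝒜,r})` of `C*_r(𝒜)` are topological. -/
def ReducedIsTopological : Prop := ∀ 𝒜 : FellBundle G, IsTopologicalGrading 𝒜 𝒜.iRed

variable (G) in
/-- Every morphism `φ : 𝒜 → ℬ` of Fell bundles induces a unique homomorphism
`φ^n : C*_r(𝒜) → C*_r(ℬ)` with `φ^n ∘ i_{𝒜,r} = i_{ℬ,r} ∘ φ^c`. -/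
def ReducedFunctorial : Prop := ∀ (𝒜 ℬ : FellBundle G) (φ : 𝒜 ⟶ ℬ),
  ∃! ψ : 𝒜.Cr →⋆ₙₐ[ℂ] ℬ.Cr, ∀ f, ψ (𝒜.iRed f) = ℬ.iRed (Hom.mapΓ φ f)

variable (G) in
/-- For every object `(A, 𝒜, i)` there is a unique homomorphism `η_A : A → C*_r(𝒜)` with
`η_A ∘ i = i_{𝒜,r}`. -/
def ReducedUniversal : Prop := ∀ X : TopGraded G,
  ∃! ψ : X.alg →⋆ₙₐ[ℂ] X.bundle.Cr, ∀ f, ψ (X.i f) = X.bundle.iRed f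

/-- The normalization functor `N`: it sends `(A, 𝒜, i)` to `(C*_r(𝒜), 𝒜, i_{𝒜,r})` and `(ϕ, φ)`
to `(φ^n, φ)`. -/
noncomputable def normalization (h₁ : ReducedIsTopological G) (h₂ : ReducedFunctorial G) :
    TopGraded G ⥤ TopGraded G where
  obj X := reduced X.bundle (h₁ X.bundle)
  map {X Y} φ := ⟨(h₂ X.bundle Y.bundle φ.fellHom).choose, φ.fellHom,
    (h₂ X.bundle Y.bundle φ.fellHom).choose_spec.1⟩
  map_id X := by
    refine Hom.ext ?_ rfl
    exact ((h₂ _ _ (𝟙 X.bundle)).choose_spec.2 (NonUnitalStarAlgHom.id ℂ _) fun _ => rfl).symm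
  map_comp {X Y Z} φ γ := by
    refine Hom.ext ?_ rfl
    refine ((h₂ _ _ (φ.fellHom ≫ γ.fellHom)).choose_spec.2
      ((h₂ _ _ γ.fellHom).choose.comp (h₂ _ _ φ.fellHom).choose) fun f => ?_).symm
    rw [NonUnitalStarAlgHom.comp_apply, (h₂ _ _ φ.fellHom).choose_spec.1,
      (h₂ _ _ γ.fellHom).choose_spec.1]
    rfl

/-- The natural transformation `η : id → N` with components `(η_A, id_𝒜)`. -/
noncomputable def unit (h₁ : ReducedIsTopological G) (h₂ : ReducedFunctorial G)
    (h₃ : ReducedUniversal G) : 𝟭 (TopGraded G) ⟶ normalization h₁ h₂ where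
  app X := ⟨(h₃ X).choose, 𝟙 X.bundle, (h₃ X).choose_spec.1⟩
  naturality X Y φ := by
    refine Hom.ext ?_ ((Category.comp_id φ.fellHom).trans (Category.id_comp φ.fellHom).symm)
    refine starHom_ext_of_denseRange (A := X.alg) (B := Y.bundle.Cr)
      X.isTopologicalGrading.denseRange
      (φ := (h₃ Y).choose.comp φ.algHom)
      (ψ := (h₂ X.bundle Y.bundle φ.fellHom).choose.comp (h₃ X).choose) fun f => ?_
    rw [NonUnitalStarAlgHom.comp_apply, NonUnitalStarAlgHom.comp_apply, φ.comm,
      (h₃ Y).choose_spec.1, (h₃ X).choose_spec.1,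
      (h₂ X.bundle Y.bundle φ.fellHom).choose_spec.1]

end TopGraded

/-- `(N, η)` is an idempotent monad: `N η = η N`, and `N η` is a natural isomorphism. -/
structure IsIdempotentMonad {C : Type*} [Category C] (N : C ⥤ C) (η : 𝟭 C ⟶ N) : Prop where
  map_app : ∀ X : C, N.map (η.app X) = η.app (N.obj X)
  isIso_map_app : ∀ X : C, IsIso (N.map (η.app X))

/-- The objects `X` for which `η_X` is an isomorphism. -/
def fixedObjects {C : Type*} [Category C] {N : C ⥤ C} (η : 𝟭 C ⟶ N) : ObjectProperty C :=
  fun X => IsIso (η.app X)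

/-! Everything reduces to comparing norms on `Γc`: a homomorphism out of a `C*`-algebra with a dense
copy of `Γc` exists, and is unique, as soon as its prescribed values are bounded by the norm there.
The theorem is thus the statement that the reduced norm is the smallest norm of a topological
grading, in a form that also covers a bundle morphism.

The central estimate is `norm_iRed_mapΓ_le`. Suppose a `C*`-seminorm `‖j ·‖` on `Γc` dominates the
supremum norm over the units. By the `C*`-identity it dominates the supremum norm over all arrows.
Put `h = f* f` and let `T n` be the image of `h ^ 2 ^ n` under `φ`, which is fibrewise contractive.
For a fixed vector `ξ` the numbers `t n = ‖⟨ξ, T n ξ⟩‖` satisfy `t n ^ 2 ≤ ‖ξ‖₂ ^ 2 * t (n + 1)` by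
Cauchy–Schwarz and self-adjointness. They also satisfy the crude bound `t n ≤ D * ‖j h‖ ^ 2 ^ n`,
where `D` depends only on `ξ`. Taking `2 ^ n`-th roots removes `D` and leaves `‖φ(f) ξ‖₂ ^ 2 ≤ ‖j f‖
^ 2 * ‖ξ‖₂ ^ 2`. With `φ = id` and `j` a topological grading this gives `η`; with `j` the regular
representation it gives `φ^n`.

Both uses need the domination hypothesis. For a topological grading it comes from the contractive
expectation `E`, together with the fact that an injective homomorphism is isometric on sections over
the units (`norm_eq_norm_toUnit_of_injective`). The latter is automatic on `C*`-algebras, and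
sections over the units vanishing off a fixed compact set do form one. For the regular
representation, `norm_toUnit_le_norm_iRed` tests the operator on a vector made from `f` itself. The
same estimate makes restriction to the units contractive for the reduced norm, so it extends to a
conditional expectation. Its positivity is checked fibre by fibre, where `(f* f)(x)` is a finite sum
of positive elements.

The categorical part is formal. The map induced by a pair depends only on its bundle component,
which is the identity for `η`; hence `N η` and `η N` are both identities. An idempotent monad
reflects onto its fixed objects, with unit `η` and counit `η⁻¹`. -/

namespace FellBundle

variable {G : Type u} [TopologicalSpace G] [EtaleGroupoid G] {𝒜 : FellBundle G}

/-! ### Pointwise estimates and sections over the unit space -/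

theorem star_apply_of_unit {x : G} (hx : rng x = x) (f : 𝒜.Γc) :
    (star f) x = 𝒜.adj (inv_of_rng hx) (f x) :=
  adj_congr f _ _ (inv_of_rng hx)

theorem star_mem_unitSections [T2Space G] {d : 𝒜.Γc} (hd : d ∈ 𝒜.unitSections) :
    star d ∈ 𝒜.unitSections := fun g hg => by
  have h : inv g ∉ unitSpace G := fun h => hg (by
    have h' := inv_of_rng h
    rw [EtaleGroupoid.inv_inv] at h'
    rwa [h'])
  rw [star_apply, hd _ h, 𝒜.adj_zero]

theorem norm_star_apply (f : 𝒜.Γc) (g : G) : ‖(star f) g‖ = ‖f (inv g)‖ :=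
  norm_adj _ _

theorem norm_adj_mul_self_unit {x : G} (hx : rng x = x) (a : 𝒜.fiber x) :
    ‖𝒜.mul (isMul_unit hx) (𝒜.adj (inv_of_rng hx) a) a‖ = ‖a‖ ^ 2 := by
  let _ : NonUnitalCStarAlgebra (𝒜.fiber x) := 𝒜.fiberCStar hx
  rw [sq]
  exact CStarRing.norm_star_mul_self (x := a)

theorem norm_ipTerm_self (f : 𝒜.Γc) {x : G} (k : SrcFiber x) : ‖ipTerm f f k‖ = ‖f k.1‖ ^ 2 := by
  obtain ⟨k, rfl⟩ := k
  exact 𝒜.norm_adj_mul_self k (f k)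

/-- This is the positivity axiom of the bundle, transported from the fibre over `src k` to the fibre
over `x`, so that terms with different `k` can be added in one `C*`-algebra. -/
theorem ipTerm_self_eq (f : 𝒜.Γc) {x : G} (hx : rng x = x) (k : SrcFiber x) :
    ∃ b : 𝒜.fiber x, ipTerm f f k = 𝒜.mul (isMul_unit hx) (𝒜.adj (inv_of_rng hx) b) b := by
  obtain ⟨k, rfl⟩ := k
  exact 𝒜.adj_mul_self_pos k (f k)

theorem unitSections_ext {d e : 𝒜.Γc} (hd : d ∈ 𝒜.unitSections) (he : e ∈ 𝒜.unitSections)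
    (h : ∀ x, rng x = x → d x = e x) : d = e := by
  ext g
  by_cases hg : g ∈ unitSpace G
  · exact h g hg
  · rw [hd g hg, he g hg]

theorem norm_apply_le_norm_toUnit (f : 𝒜.Γc) {x : G} (hx : rng x = x) : ‖f x‖ ≤ ‖toUnit f‖ :=
  lp.norm_apply_le_norm ENNReal.top_ne_zero (toUnit f) ⟨x, hx⟩

theorem norm_toUnit_le (f : 𝒜.Γc) {C : ℝ} (hC : 0 ≤ C) (h : ∀ x, rng x = x → ‖f x‖ ≤ C) :
    ‖toUnit f‖ ≤ C :=
  lp.norm_le_of_forall_le hC fun x => h x.1 x.2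

variable [T2Space G]

/-- `(f* f)(x)` is a positive element of the fibre over the unit `x`. -/
theorem exists_star_mul_self_apply_unit (f : 𝒜.Γc) {x : G} (hx : rng x = x) :
    ∃ b : 𝒜.fiber x,
      (star f * f) x = 𝒜.mul (isMul_unit hx) (𝒜.adj (inv_of_rng hx) b) b := by
  let _ : NonUnitalCStarAlgebra (𝒜.fiber x) := 𝒜.fiberCStar hx
  let _ : PartialOrder (𝒜.fiber x) := CStarAlgebra.spectralOrder _
  have : StarOrderedRing (𝒜.fiber x) := CStarAlgebra.spectralOrderedRing _
  have h : 0 ≤ (star f * f) x := by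
    rw [star_mul_apply_unit hx]
    refine finsum_nonneg fun k => ?_
    obtain ⟨b, hb⟩ := ipTerm_self_eq f hx k
    rw [hb]
    exact star_mul_self_nonneg b
  exact CStarAlgebra.nonneg_iff_eq_star_mul_self.1 h

/-- The right-hand element is a sum of positive terms, one of which is `f(g)* f(g)`, and the norm is
monotone on positive elements. This is how bounds over the units become bounds over all arrows. -/
theorem sq_norm_apply_le (f : 𝒜.Γc) (g : G) : ‖f g‖ ^ 2 ≤ ‖(star f * f) (src g)‖ := by
  have hx : rng (src g) = src g := rng_src g
  let _ : NonUnitalCStarAlgebra (𝒜.fiber (src g)) := 𝒜.fiberCStar hx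
  let _ : PartialOrder (𝒜.fiber (src g)) := CStarAlgebra.spectralOrder _
  have : StarOrderedRing (𝒜.fiber (src g)) := CStarAlgebra.spectralOrderedRing _
  have hpos : ∀ k : SrcFiber (src g), 0 ≤ ipTerm f f k := fun k => by
    obtain ⟨b, hb⟩ := ipTerm_self_eq f hx k
    rw [hb]
    exact star_mul_self_nonneg b
  have hfin : (Function.support (ipTerm (x := src g) f f)).Finite :=
    (finite_srcFiber f).subset fun k hk h => hk (by simp only [ipTerm, h, 𝒜.mul_zero])
  rw [star_mul_apply_unit hx, ← norm_ipTerm_self f ⟨g, rfl⟩]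
  refine CStarAlgebra.norm_le_norm_of_nonneg_of_le (ha := hpos _) ?_
  exact single_le_finsum _ hfin hpos

/-- Multiplication by a section that is supported in the unit space. -/
theorem mul_apply_unit_left {d : 𝒜.Γc} (hd : d ∈ 𝒜.unitSections) (f : 𝒜.Γc) {x : G}
    (hx : rng x = x) : (d * f) x = 𝒜.mul (isMul_unit hx) (d x) (f x) := by
  rw [mul_apply, finsum_eq_single _ (show Factor x from ⟨(x, x), isMul_unit hx⟩)]
  · rfl
  · intro p hp
    rw [convTerm, hd, 𝒜.zero_mul]
    -- In a factorisation of a unit `x`, a first factor that is itself a unit must be `x`; so only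
    -- the pair `(x, x)` contributes.
    intro h
    refine hp (factor_ext ?_)
    have h' : rng p.1.1 = p.1.1 := h
    rw [← h', ← p.2.rng_eq, hx]

theorem mul_apply_unit_right (f : 𝒜.Γc) {d : 𝒜.Γc} (hd : d ∈ 𝒜.unitSections) {x : G}
    (hx : rng x = x) : (f * d) x = 𝒜.mul (isMul_unit hx) (f x) (d x) := by
  rw [mul_apply, finsum_eq_single _ (show Factor x from ⟨(x, x), isMul_unit hx⟩)]
  · rfl
  · intro p hp
    rw [convTerm, hd, 𝒜.mul_zero]
    intro h
    have h' : rng p.1.2 = p.1.2 := h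
    have h1 : p.1.2 = x := by
      rw [← src_of_rng h', ← p.2.src_eq, src_of_rng hx]
    have h2 := p.2
    rw [h1] at h2
    exact hp (factor_ext (h2.left_unique (isMul_unit hx)))

theorem mul_mem_unitSections {d e : 𝒜.Γc} (hd : d ∈ 𝒜.unitSections) (he : e ∈ 𝒜.unitSections) :
    d * e ∈ 𝒜.unitSections := fun g hg => by
  rw [mul_apply]
  refine finsum_eq_zero_of_forall_eq_zero fun p => ?_
  by_cases h1 : p.1.1 ∈ unitSpace G
  · rw [convTerm, he, 𝒜.mul_zero]
    intro h2
    have hc : src p.1.1 = rng p.1.2 := p.2.choose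
    have h1' : rng p.1.1 = p.1.1 := h1
    have h2' : rng p.1.2 = p.1.2 := h2
    have h12 : p.1.1 = p.1.2 := by rw [← src_of_rng h1', hc, h2']
    have h3 := p.2
    rw [← h12] at h3
    exact hg ((isMul_unit h1').unique h3 ▸ h1)
  · rw [convTerm, hd _ h1, 𝒜.zero_mul]

theorem restrictUnit_mem (f : 𝒜.Γc) : restrictUnit f ∈ 𝒜.unitSections := fun _ hg => if_neg hg

theorem restrictUnit_apply_unit (f : 𝒜.Γc) {x : G} (hx : rng x = x) : restrictUnit f x = f x :=
  if_pos hx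

theorem restrictUnit_of_mem {d : 𝒜.Γc} (hd : d ∈ 𝒜.unitSections) : restrictUnit d = d :=
  unitSections_ext (restrictUnit_mem d) hd fun _ hx => restrictUnit_apply_unit d hx

theorem restrictUnit_mul_left {d : 𝒜.Γc} (hd : d ∈ 𝒜.unitSections) (f : 𝒜.Γc) :
    restrictUnit (d * f) = d * restrictUnit f :=
  unitSections_ext (restrictUnit_mem _) (mul_mem_unitSections hd (restrictUnit_mem f))
    fun x hx => by
      rw [restrictUnit_apply_unit _ hx, mul_apply_unit_left hd _ hx, mul_apply_unit_left hd _ hx,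
        restrictUnit_apply_unit _ hx]

theorem restrictUnit_mul_right (f : 𝒜.Γc) {d : 𝒜.Γc} (hd : d ∈ 𝒜.unitSections) :
    restrictUnit (f * d) = restrictUnit f * d :=
  unitSections_ext (restrictUnit_mem _) (mul_mem_unitSections (restrictUnit_mem f) hd)
    fun x hx => by
      rw [restrictUnit_apply_unit _ hx, mul_apply_unit_right _ hd hx,
        mul_apply_unit_right _ hd hx, restrictUnit_apply_unit _ hx]

theorem toUnit_restrictUnit (f : 𝒜.Γc) : toUnit (restrictUnit f) = toUnit f := by
  ext x
  exact restrictUnit_apply_unit f x.2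

/-- Consequently `norm₂` is a norm on `Γc`, not merely a seminorm, so `Γc` embeds in its completion.
-/
theorem norm_apply_le_norm₂ (f : 𝒜.Γc) (g : G) : ‖f g‖ ≤ norm₂ f := by
  refine le_of_sq_le_sq ?_ (norm₂_nonneg f)
  rw [sq_norm₂]
  exact (sq_norm_apply_le f g).trans (norm_apply_le_norm_toUnit (star f * f) (rng_src g))

theorem eq_zero_of_norm₂_eq_zero {f : 𝒜.Γc} (h : norm₂ f = 0) : f = 0 := by
  ext g
  exact norm_le_zero_iff.1 (h ▸ norm_apply_le_norm₂ f g)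

/-- Convolution is bounded from the supremum norm to the supremum norm. -/
theorem norm_mul_apply_le (u ξ : 𝒜.Γc) {C : ℝ} (hC : 0 ≤ C) (hu : ∀ g, ‖u g‖ ≤ C) (g : G) :
    ‖(u * ξ) g‖ ≤ C * (colNorm ξ).toReal := by
  have h1 : ‖(u * ξ) g‖ₑ ≤ ENNReal.ofReal C * colNorm ξ := by
    -- A factorisation of `g` is determined by its second factor, an arrow with the source of `g`;
    -- hence the sum over factorisations is at most a column sum of `ξ`.
    let ι : Factor g → SrcFiber (src g) := fun p => ⟨p.1.2, p.2.src_eq.symm⟩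
    have hι : Function.Injective ι := fun p q h => by
      have h' : p.1.2 = q.1.2 := congrArg Subtype.val h
      have hq := q.2
      rw [← h'] at hq
      exact factor_ext (p.2.left_unique hq)
    calc ‖(u * ξ) g‖ₑ ≤ ∑' p : Factor g, ‖convTerm (𝒜 := 𝒜) u ξ g p‖ₑ :=
          enorm_finsum_le _ (finite_support_convTerm u ξ g)
      _ ≤ ∑' p : Factor g, ENNReal.ofReal C * ‖ξ (ι p).1‖ₑ := by
          refine ENNReal.tsum_le_tsum fun p => ?_
          rw [← ofReal_norm, ← ofReal_norm, ← ENNReal.ofReal_mul hC]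
          refine ENNReal.ofReal_le_ofReal ((𝒜.norm_mul_le _ _ _).trans ?_)
          exact mul_le_mul_of_nonneg_right (hu _) (norm_nonneg _)
      _ = ENNReal.ofReal C * ∑' p : Factor g, ‖ξ (ι p).1‖ₑ := ENNReal.tsum_mul_left
      _ ≤ ENNReal.ofReal C * colNorm ξ := by
          refine mul_le_mul_right ?_ _
          exact (ENNReal.tsum_comp_le_tsum_of_injective hι fun k : SrcFiber (src g) =>
            ‖ξ k.1‖ₑ).trans (tsum_le_colNorm ξ _)
  have h2 := ENNReal.toReal_mono
    (ENNReal.mul_ne_top ENNReal.ofReal_ne_top (colNorm_ne_top ξ)) h1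
  rwa [ENNReal.toReal_mul, ENNReal.toReal_ofReal hC, toReal_enorm] at h2

/-- A crude bound that sees `u` only through its supremum norm. The constant in `ξ` is far from
sharp, but it does not depend on `u`, and this is all that the limit argument with powers requires.
-/
theorem norm_ip_mul_le (u ξ : 𝒜.Γc) {C : ℝ} (hC : 0 ≤ C) (hu : ∀ g, ‖u g‖ ≤ C) :
    ‖ip ξ (u * ξ)‖ ≤ C * (colNorm ξ).toReal * (colNorm ξ).toReal := by
  have hC' : 0 ≤ C * (colNorm ξ).toReal := mul_nonneg hC ENNReal.toReal_nonneg
  refine norm_toUnit_le _ (mul_nonneg hC' ENNReal.toReal_nonneg) fun x _ => ?_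
  -- The convolution bound measures the right factor by its column norm; passing to the adjoint puts
  -- `ξ` on the right a second time.
  have h : star ξ * (u * ξ) = star (star (u * ξ) * ξ) := by rw [star_mul, star_star]
  rw [h, norm_star_apply]
  refine norm_mul_apply_le _ _ hC' (fun g => ?_) _
  rw [norm_star_apply]
  exact norm_mul_apply_le _ _ hC hu _

/-- The norm of a section that is supported in the unit space. -/
theorem norm₂_of_mem {d : 𝒜.Γc} (hd : d ∈ 𝒜.unitSections) : norm₂ d = ‖toUnit d‖ := by
  have key : ∀ x, rng x = x → ‖(star d * d) x‖ = ‖d x‖ ^ 2 := fun x hx => by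
    rw [mul_apply_unit_right _ hd hx, star_apply_of_unit hx, norm_adj_mul_self_unit hx]
  refine le_antisymm (le_of_sq_le_sq ?_ (norm_nonneg _))
    (norm_toUnit_le _ (norm₂_nonneg d) fun x _ => norm_apply_le_norm₂ d x)
  rw [sq_norm₂]
  refine norm_toUnit_le _ (sq_nonneg _) fun x hx => ?_
  rw [key x hx]
  exact pow_le_pow_left₀ (norm_nonneg _) (norm_apply_le_norm_toUnit d hx) 2

end FellBundle

/-! ### A growth lemma and extension of homomorphisms by density -/

/-- If `t n ^ 2 ≤ b * t (n + 1)` and `t n` grows at most like `c ^ (2 ^ n)`, then `t 0 ≤ c * b`. -/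
theorem le_mul_of_sq_le_mul_succ {t : ℕ → ℝ} {b c D : ℝ} (hb : 0 ≤ b)
    (hc : 0 ≤ c) (hsq : ∀ n, t n ^ 2 ≤ b * t (n + 1)) (hD : ∀ n, t n ≤ D * c ^ 2 ^ n) :
    t 0 ≤ c * b := by
  by_contra! hlt
  have ht0 : 0 < t 0 := (mul_nonneg hc hb).trans_lt hlt
  -- Iterated squaring would give `t 0 ^ 2 ^ n ≤ b ^ (2 ^ n - 1) * t n`; the extra factor `b` avoids
  -- the truncated subtraction.
  have hpow : ∀ n, t 0 ^ 2 ^ n * b ≤ b ^ 2 ^ n * t n := by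
    intro n
    induction n with
    | zero => simp [mul_comm]
    | succ n ih =>
      rcases hb.eq_or_lt with h0 | h0
      · simp [← h0]
      · have h1 : (t 0 ^ 2 ^ n * b) ^ 2 ≤ (b ^ 2 ^ n * t n) ^ 2 :=
          pow_le_pow_left₀ (by positivity) ih 2
        have h2 : (b ^ 2 ^ n * t n) ^ 2 ≤ (b ^ 2 ^ n) ^ 2 * (b * t (n + 1)) := by
          rw [mul_pow]
          exact mul_le_mul_of_nonneg_left (hsq n) (by positivity)
        refine le_of_mul_le_mul_right ?_ h0
        calc t 0 ^ 2 ^ (n + 1) * b * b = (t 0 ^ 2 ^ n * b) ^ 2 := by rw [pow_succ]; ring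
          _ ≤ _ := h1.trans h2
          _ = b ^ 2 ^ (n + 1) * t (n + 1) * b := by rw [pow_succ 2 n, pow_mul]; ring
  have hb0 : 0 < b := by
    rcases hb.eq_or_lt with h0 | h0
    · have h1 := hsq 0
      rw [← h0, zero_mul] at h1
      have h2 : 0 < t 0 ^ 2 := by positivity
      linarith
    · exact h0
  -- Inserting the growth bound into `hpow` gives `b ≤ (c * b / t 0) ^ 2 ^ n * D`, whose right-hand
  -- side tends to `0`.
  have hq : c * b / t 0 < 1 := (div_lt_one ht0).2 hlt
  have hlim : Tendsto (fun n : ℕ => (c * b / t 0) ^ 2 ^ n * D) atTop (𝓝 (0 * D)) :=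
    ((tendsto_pow_atTop_nhds_zero_of_lt_one (by positivity) hq).comp
      (tendsto_pow_atTop_atTop_of_one_lt (by norm_num : 1 < 2))).mul_const D
  rw [zero_mul] at hlim
  refine hb0.not_ge (ge_of_tendsto' hlim fun n => ?_)
  rw [div_pow, div_mul_eq_mul_div, le_div_iff₀ (by positivity), mul_comm b]
  calc t 0 ^ 2 ^ n * b ≤ b ^ 2 ^ n * t n := hpow n
    _ ≤ b ^ 2 ^ n * (D * c ^ 2 ^ n) := mul_le_mul_of_nonneg_left (hD n) (by positivity)
    _ = (c * b) ^ 2 ^ n * D := by rw [mul_pow]; ring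

/-- A homomorphism that is dominated by a homomorphism with dense range factors through it. -/
theorem existsUnique_starHom_of_norm_le {Γ C D : Type u} [NonUnitalRing Γ] [StarRing Γ]
    [Module ℂ Γ] [NonUnitalCStarAlgebra C] [NonUnitalCStarAlgebra D] (j : Γ →⋆ₙₐ[ℂ] C)
    (hj : DenseRange j) (k : Γ →⋆ₙₐ[ℂ] D) (hk : ∀ f, ‖k f‖ ≤ ‖j f‖) :
    ∃! ψ : C →⋆ₙₐ[ℂ] D, ∀ f, ψ (j f) = k f := by
  let jl : Γ →ₗ[ℂ] C := { toFun := j, map_add' := map_add j, map_smul' := map_smul j }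
  let kl : Γ →ₗ[ℂ] D := { toFun := k, map_add' := map_add k, map_smul' := map_smul k }
  have hbd : ∀ f, ‖kl f‖ ≤ 1 * ‖jl f‖ := fun f => by rw [one_mul]; exact hk f
  let e := kl.extendOfNorm jl
  have he : ∀ f, e (j f) = k f := fun f => LinearMap.extendOfNorm_eq hj ⟨1, hbd⟩ f
  -- The bounded linear extension is multiplicative and preserves the involution because both
  -- identities are closed conditions that hold on the range of `j`.
  have hmul : ∀ a b, e (a * b) = e a * e b := fun a b => by
    refine hj.induction_on₂ (p := fun a b => e (a * b) = e a * e b)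
      (isClosed_eq (by fun_prop) (by fun_prop)) (fun f f' => ?_) a b
    rw [← map_mul, he, he, he, map_mul]
  have hstar : ∀ a, e (star a) = star (e a) := fun a => by
    refine hj.induction_on (p := fun a => e (star a) = star (e a)) a
      (isClosed_eq (by fun_prop) (by fun_prop)) fun f => ?_
    rw [← map_star, he, he, map_star]
  let ψ₀ : C →⋆ₙₐ[ℂ] D :=
    { toFun := e
      map_smul' := map_smul e
      map_zero' := map_zero e
      map_add' := map_add e
      map_mul' := hmul
      map_star' := hstar }
  exact ⟨ψ₀, he, fun ψ hψ => starHom_ext_of_denseRange hj fun f => (hψ f).trans (he f).symm⟩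

/-! ### The reduced norm and its minimality -/

namespace FellBundle

variable {G : Type u} [TopologicalSpace G] [T2Space G] [EtaleGroupoid G] {𝒜 ℬ : FellBundle G}

theorem norm_iRed (f : 𝒜.Γc) : ‖𝒜.iRed f‖ = ‖lmul f‖ := rfl

theorem norm₂_mul_le_iRed (f ξ : 𝒜.Γc) : norm₂ (f * ξ) ≤ ‖𝒜.iRed f‖ * norm₂ ξ := by
  have h := (lmul f).le_opNorm ((show 𝒜.L2Pre from ξ : 𝒜.L2Pre) : 𝒜.L2)
  rw [lmul_coe, UniformSpace.Completion.norm_coe, UniformSpace.Completion.norm_coe] at h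
  exact h

theorem norm_iRed_le (f : 𝒜.Γc) {C : ℝ} (hC : 0 ≤ C)
    (h : ∀ ξ : 𝒜.Γc, norm₂ (f * ξ) ≤ C * norm₂ ξ) : ‖𝒜.iRed f‖ ≤ C := by
  refine (lmul f).opNorm_le_bound hC fun ξ => ?_
  refine UniformSpace.Completion.induction_on ξ
    (isClosed_le (lmul f).continuous.norm (by fun_prop)) fun ξ => ?_
  rw [lmul_coe, UniformSpace.Completion.norm_coe, UniformSpace.Completion.norm_coe]
  exact h ξ

/-- The algebra need not contain a unit to test an operator on, so the vector `f*` is used: `f f* =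
0` says that the inner square of `f*` vanishes, and `norm₂` is definite. -/
theorem iRed_injective : Function.Injective 𝒜.iRed := by
  rw [injective_iff_map_eq_zero]
  intro f hf
  have h1 : f * star f = 0 := by
    refine eq_zero_of_norm₂_eq_zero (le_antisymm ?_ (norm₂_nonneg _))
    have := norm₂_mul_le_iRed f (star f)
    rwa [hf, norm_zero, MulZeroClass.zero_mul] at this
  have h2 : star f = 0 := by
    refine eq_zero_of_norm₂_eq_zero ?_
    rw [norm₂, ip, star_star, h1, map_zero, norm_zero, Real.sqrt_zero]
  rw [← star_star f, h2, star_zero]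

theorem iRed_denseRange : DenseRange 𝒜.iRed := by
  intro a
  have h : (a : 𝒜.reducedSubalgebra).1 ∈ closure (Set.range 𝒜.regRep) := by
    have := (a : 𝒜.reducedSubalgebra).2
    exact this
  refine (Topology.IsInducing.subtypeVal (t := {a | a ∈ 𝒜.reducedSubalgebra})).closure_eq_preimage_closure_image
    (Set.range 𝒜.iRed) ▸ ?_
  refine closure_mono ?_ h
  rintro _ ⟨f, rfl⟩
  exact ⟨_, ⟨f, rfl⟩, rfl⟩

/-- Convolution operators are bounded by any `C*`-norm that dominates the supremum norm over the
unit space. -/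
theorem norm_iRed_mapΓ_le (φ : 𝒜 ⟶ ℬ) {C : Type u} [NonUnitalCStarAlgebra C]
    (j : 𝒜.Γc →⋆ₙₐ[ℂ] C) (hj : ∀ (u : 𝒜.Γc) (x : G), rng x = x → ‖u x‖ ≤ ‖j u‖) (f : 𝒜.Γc) :
    ‖ℬ.iRed (Hom.mapΓ φ f)‖ ≤ ‖j f‖ := by
  -- Domination over the units, applied to `u* u`, extends to all arrows by the `C*`-identity in
  -- `C`.
  have hj' : ∀ (u : 𝒜.Γc) (g : G), ‖u g‖ ≤ ‖j u‖ := fun u g => by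
    refine le_of_sq_le_sq ?_ (norm_nonneg _)
    refine (sq_norm_apply_le u g).trans ((hj _ _ (rng_src g)).trans ?_)
    rw [map_mul, map_star, CStarRing.norm_star_mul_self, sq]
  -- Over a unit, `φ` is a homomorphism of `C*`-algebras and hence contractive; over other arrows
  -- the `C*`-identity reduces the bound to `a* a`.
  have hφ : ∀ (g : G) (a : 𝒜.fiber g), ‖φ.toFun g a‖ ≤ ‖a‖ := by
    have hunit : ∀ (x : G), rng x = x → ∀ a : 𝒜.fiber x, ‖φ.toFun x a‖ ≤ ‖a‖ := by
      intro x hx a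
      let _ : NonUnitalCStarAlgebra (𝒜.fiber x) := 𝒜.fiberCStar hx
      let _ : NonUnitalCStarAlgebra (ℬ.fiber x) := ℬ.fiberCStar hx
      let φx : 𝒜.fiber x →⋆ₙₐ[ℂ] ℬ.fiber x :=
        { toFun := φ.toFun x
          map_smul' := fun c a => map_smul (φ.toFun x) c a
          map_zero' := map_zero (φ.toFun x)
          map_add' := map_add (φ.toFun x)
          map_mul' := φ.map_mul (isMul_unit hx)
          map_star' := φ.map_adj (inv_of_rng hx) }
      exact NonUnitalStarAlgHom.norm_apply_le φx a
    intro g a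
    refine le_of_sq_le_sq ?_ (norm_nonneg _)
    rw [← ℬ.norm_adj_mul_self, ← 𝒜.norm_adj_mul_self, ← φ.map_adj, ← φ.map_mul]
    exact hunit _ (rng_src g) _
  -- `F n` is `(f* f) ^ 2 ^ n`, defined by repeated squaring because `Γc` need not have a unit.
  let F : ℕ → 𝒜.Γc := fun n => Nat.rec (star f * f) (fun _ u => u * u) n
  have hF0 : F 0 = star f * f := rfl
  have hFs : ∀ n, F (n + 1) = F n * F n := fun n => rfl
  have hFstar : ∀ n, star (F n) = F n := by
    intro n
    induction n with
    | zero => rw [hF0, star_mul, star_star]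
    | succ n ih => rw [hFs, star_mul, ih]
  have hjF : ∀ n, ‖j (F n)‖ ≤ ‖j (star f * f)‖ ^ 2 ^ n := by
    intro n
    induction n with
    | zero => simp [hF0]
    | succ n ih =>
      rw [hFs, map_mul, pow_succ 2 n, pow_mul, sq]
      exact (_root_.norm_mul_le _ _).trans (mul_le_mul ih ih (norm_nonneg _) (by positivity))
  refine norm_iRed_le _ (norm_nonneg _) fun ξ => ?_
  let T : ℕ → ℬ.Γc := fun n => Hom.mapΓ φ (F n)
  have hTstar : ∀ n, star (T n) = T n := fun n => by rw [← map_star, hFstar]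
  have hTs : ∀ n, norm₂ (T n * ξ) ^ 2 = ‖ip ξ (T (n + 1) * ξ)‖ := fun n => by
    have h : T (n + 1) = T n * T n := by simp only [T, hFs, map_mul]
    rw [sq_norm₂, ip_mul, hTstar, h, _root_.mul_assoc]
  have key : ‖ip ξ (T 0 * ξ)‖ ≤ ‖j (star f * f)‖ * norm₂ ξ ^ 2 := by
    -- The growth lemma applies with `b = ‖ξ‖₂ ^ 2` and `c = ‖j (f* f)‖`: its first hypothesis is
    -- Cauchy–Schwarz, its second the crude bound for `T n`.
    refine le_mul_of_sq_le_mul_succ (t := fun n => ‖ip ξ (T n * ξ)‖)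
      (D := (colNorm ξ).toReal * (colNorm ξ).toReal) (sq_nonneg _)
      (norm_nonneg _) (fun n => ?_) fun n => ?_
    · rw [← hTs, ← mul_pow]
      exact pow_le_pow_left₀ (norm_nonneg _) (norm_ip_le' _ _) 2
    · have h := norm_ip_mul_le (T n) ξ (C := ‖j (star f * f)‖ ^ 2 ^ n) (by positivity)
        fun g => (hφ g _).trans ((hj' (F n) g).trans (hjF n))
      refine h.trans (le_of_eq ?_)
      ring
  refine le_of_sq_le_sq ?_ (mul_nonneg (norm_nonneg _) (norm₂_nonneg _))
  rw [mul_pow, sq_norm₂, ip_mul, ← _root_.mul_assoc, ← map_star, ← map_mul, sq ‖j f‖,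
    ← CStarRing.norm_star_mul_self (x := j f), ← map_star, ← map_mul]
  exact key

end FellBundle

/-! ### The `C*`-algebras of sections over compact sets of units -/

namespace FellBundle

variable {G : Type u} [TopologicalSpace G] [EtaleGroupoid G] {𝒜 : FellBundle G}

/-- Continuity of addition on the fibre product, unfolded to neighbourhoods in the total space so
that the summands can be controlled separately. -/
theorem exists_nhds_add {g₀ : G} {a₀ b₀ : 𝒜.fiber g₀} {W : Set (BundleTotal 𝒜.fiber)}
    (hW : W ∈ 𝓝 (⟨g₀, a₀ + b₀⟩ : BundleTotal 𝒜.fiber)) :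
    ∃ U ∈ 𝓝 (⟨g₀, a₀⟩ : BundleTotal 𝒜.fiber), ∃ V ∈ 𝓝 (⟨g₀, b₀⟩ : BundleTotal 𝒜.fiber),
      ∀ (g : G) (a b : 𝒜.fiber g), (⟨g, a⟩ : BundleTotal 𝒜.fiber) ∈ U →
        (⟨g, b⟩ : BundleTotal 𝒜.fiber) ∈ V → (⟨g, a + b⟩ : BundleTotal 𝒜.fiber) ∈ W := by
  let _ : TopologicalSpace (Σ g, 𝒜.fiber g × 𝒜.fiber g) :=
    TopologicalSpace.induced (fun q =>
      ((⟨q.1, q.2.1⟩ : BundleTotal 𝒜.fiber), (⟨q.1, q.2.2⟩ : BundleTotal 𝒜.fiber))) inferInstance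
  have h := (𝒜.continuous_add.tendsto (⟨g₀, a₀, b₀⟩ : Σ g, 𝒜.fiber g × 𝒜.fiber g)) hW
  rw [nhds_induced, nhds_prod_eq] at h
  obtain ⟨S, hS, hSW⟩ := h
  obtain ⟨U, hU, V, hV, hUV⟩ := mem_prod_iff.1 hS
  exact ⟨U, hU, V, hV, fun g a b ha hb =>
    hSW (a := (⟨g, a, b⟩ : Σ g, 𝒜.fiber g × 𝒜.fiber g)) (hUV ⟨ha, hb⟩)⟩

theorem exists_norm_lt_mem_nhds_zero {g₀ : G} {V : Set (BundleTotal 𝒜.fiber)}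
    (hV : V ∈ 𝓝 (⟨g₀, 0⟩ : BundleTotal 𝒜.fiber)) :
    ∃ ε > 0, ∀ᶠ g in 𝓝 g₀, ∀ b : 𝒜.fiber g, ‖b‖ < ε → (⟨g, b⟩ : BundleTotal 𝒜.fiber) ∈ V := by
  -- The bundle axiom is applied to the coarsest filter that satisfies its hypotheses, which yields
  -- a basic neighbourhood of the zero vector: a tube around the zero section.
  have h := 𝒜.tendsto_zero (comap (fun a => a.base) (𝓝 g₀) ⊓ comap (fun a => ‖a.val‖) (𝓝 0)) g₀
    (tendsto_comap.mono_left inf_le_left) (tendsto_comap.mono_left inf_le_right) hV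
  obtain ⟨S, ⟨U, hU, hUS⟩, S', ⟨R, hR, hRS⟩, rfl⟩ := mem_inf_iff.1 h
  obtain ⟨ε, hε, hball⟩ := Metric.mem_nhds_iff.1 hR
  refine ⟨ε, hε, ?_⟩
  filter_upwards [hU] with g hg b hb
  exact ⟨hUS hg, hRS (hball (by simpa using hb))⟩

/-- Uniform limits of continuous sections are continuous. -/
theorem continuous_tot_of_uniform_approx {f : ∀ g, 𝒜.fiber g}
    (h : ∀ ε > 0, ∃ f' : ∀ g, 𝒜.fiber g, Continuous (𝒜.tot f') ∧ ∀ g, ‖f g - f' g‖ < ε) :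
    Continuous (𝒜.tot f) := by
  rw [continuous_iff_continuousAt]
  intro g₀ W hW
  have hW' : W ∈ 𝓝 (⟨g₀, f g₀ + 0⟩ : BundleTotal 𝒜.fiber) := by rw [add_zero]; exact hW
  obtain ⟨U, hU, V, hV, hUV⟩ := exists_nhds_add hW'
  -- Addition is used twice: at `g₀` to pass from `f` to `f'`, and near `g₀` to return from `f'` to
  -- `f`. The interior is taken because it has to be a neighbourhood of `f' g₀`, not only of `f g₀`.
  have hU' : interior U ∈ 𝓝 (⟨g₀, f g₀ + 0⟩ : BundleTotal 𝒜.fiber) := by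
    rw [add_zero]; exact interior_mem_nhds.2 hU
  obtain ⟨U₂, hU₂, V₂, hV₂, hUV₂⟩ := exists_nhds_add hU'
  obtain ⟨ε, hε, hεV⟩ := exists_norm_lt_mem_nhds_zero hV
  obtain ⟨δ, hδ, hδV⟩ := exists_norm_lt_mem_nhds_zero hV₂
  obtain ⟨f', hf', hff'⟩ := h (min ε δ) (lt_min hε hδ)
  have h0 : 𝒜.tot f' g₀ ∈ interior U := by
    have h1 := hUV₂ g₀ (f g₀) (f' g₀ - f g₀) (mem_of_mem_nhds hU₂)
      (hδV.self_of_nhds _ (by rw [norm_sub_rev]; exact (hff' g₀).trans_le (min_le_right _ _)))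
    rwa [add_sub_cancel] at h1
  have h1 : ∀ᶠ g in 𝓝 g₀, 𝒜.tot f' g ∈ interior U :=
    hf'.continuousAt.eventually (isOpen_interior.mem_nhds h0)
  change ∀ᶠ g in 𝓝 g₀, 𝒜.tot f g ∈ W
  filter_upwards [h1, hεV] with g hg hgV
  have h2 := hUV g (f' g) (f g - f' g) (interior_subset hg)
    (hgV _ ((hff' g).trans_le (min_le_left _ _)))
  rwa [add_sub_cancel] at h2

variable [T2Space G]

variable (𝒜) in
/-- The sections that are supported in the unit space and vanish outside `K`. -/
def unitSubalgebra (K : Set G) : NonUnitalStarSubalgebra ℂ 𝒜.Γc where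
  carrier := {d | d ∈ 𝒜.unitSections ∧ ∀ g ∉ K, d g = 0}
  zero_mem' := ⟨fun _ _ => rfl, fun _ _ => rfl⟩
  add_mem' {d e} hd he :=
    ⟨fun g hg => by rw [Γc.add_apply, hd.1 g hg, he.1 g hg, add_zero],
      fun g hg => by rw [Γc.add_apply, hd.2 g hg, he.2 g hg, add_zero]⟩
  smul_mem' c d hd :=
    ⟨fun g hg => by rw [Γc.smul_apply, hd.1 g hg, smul_zero],
      fun g hg => by rw [Γc.smul_apply, hd.2 g hg, smul_zero]⟩
  mul_mem' {d e} hd he := by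
    refine ⟨mul_mem_unitSections hd.1 he.1, fun g hg => ?_⟩
    by_cases hu : g ∈ unitSpace G
    · rw [mul_apply_unit_left hd.1 e hu, hd.2 g hg, 𝒜.zero_mul]
    · exact mul_mem_unitSections hd.1 he.1 g hu
  star_mem' {d} hd := by
    refine ⟨star_mem_unitSections hd.1, fun g hg => ?_⟩
    by_cases hu : g ∈ unitSpace G
    · rw [star_apply_of_unit hu, hd.2 g hg, 𝒜.adj_zero]
    · exact star_mem_unitSections hd.1 g hu

theorem exists_mem_unitSubalgebra {d : 𝒜.Γc} (hd : d ∈ 𝒜.unitSections) :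
    ∃ K : Set G, IsCompact K ∧ d ∈ 𝒜.unitSubalgebra K := by
  obtain ⟨K, hK, h⟩ := d.2.2
  exact ⟨K, hK, hd, h⟩

/-- The inclusion of sections that are supported in the unit space into the bounded families. -/
noncomputable def unitSubalgebraToUnit (K : Set G) : 𝒜.unitSubalgebra K →ₗ[ℂ] 𝒜.unitBdd where
  toFun d := toUnit d.1
  map_add' d e := map_add toUnit d.1 e.1
  map_smul' c d := map_smul toUnit c d.1

theorem unitSubalgebraToUnit_injective (K : Set G) :
    Function.Injective (unitSubalgebraToUnit (𝒜 := 𝒜) K) := fun d e h =>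
  Subtype.ext (unitSections_ext d.2.1 e.2.1 fun x hx =>
    congrArg (fun b : 𝒜.unitBdd => b ⟨x, hx⟩) h)

/-- A supremum-norm limit, extended by zero off the units, is a uniform limit of continuous sections
and still vanishes off `K`. Fixing `K` is what makes the space complete, since the supports of a
convergent sequence might otherwise grow without bound. -/
theorem isClosed_range_unitSubalgebraToUnit {K : Set G} (hK : IsCompact K) :
    IsClosed (Set.range (unitSubalgebraToUnit (𝒜 := 𝒜) K)) := by
  classical
  refine isClosed_of_closure_subset fun b hb => ?_
  let f : ∀ g, 𝒜.fiber g := fun g => if h : g ∈ unitSpace G then b ⟨g, h⟩ else 0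
  have hf : ∀ (d : 𝒜.unitSubalgebra K) (g : G), ‖f g - d.1 g‖ ≤ ‖b - toUnit d.1‖ := by
    intro d g
    by_cases hg : g ∈ unitSpace G
    · simp only [f, dif_pos hg]
      exact lp.norm_apply_le_norm ENNReal.top_ne_zero (b - toUnit d.1) ⟨g, hg⟩
    · simp only [f, dif_neg hg, d.2.1 g hg, sub_zero, norm_zero]
      exact norm_nonneg _
  have happ : ∀ ε > 0, ∃ d : 𝒜.unitSubalgebra K, ∀ g, ‖f g - d.1 g‖ < ε := by
    intro ε hε
    obtain ⟨_, ⟨d, rfl⟩, hd⟩ := Metric.mem_closure_iff.1 hb ε hε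
    rw [dist_eq_norm] at hd
    exact ⟨d, fun g => (hf d g).trans_lt hd⟩
  have hsupp : ∀ g ∉ K, f g = 0 := by
    intro g hg
    refine norm_le_zero_iff.1 (le_of_forall_pos_lt_add fun ε hε => ?_)
    obtain ⟨d, hd⟩ := happ ε hε
    have := hd g
    rwa [d.2.2 g hg, sub_zero, ← zero_add ε] at this
  have hcont : Continuous (𝒜.tot f) := continuous_tot_of_uniform_approx fun ε hε => by
    obtain ⟨d, hd⟩ := happ ε hε
    exact ⟨_, d.1.continuous, hd⟩
  refine ⟨⟨⟨f, hcont, K, hK, hsupp⟩, fun g hg => dif_neg hg, hsupp⟩, ?_⟩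
  ext x
  exact dif_pos x.2

/-- The continuous sections of `𝒜⁰` that vanish outside a compact set form a `C*`-algebra. -/
noncomputable abbrev unitSubalgebraCStar {K : Set G} (hK : IsCompact K) :
    NonUnitalCStarAlgebra (𝒜.unitSubalgebra K) :=
  letI nag : NormedAddCommGroup (𝒜.unitSubalgebra K) :=
    NormedAddCommGroup.induced _ _ (unitSubalgebraToUnit (𝒜 := 𝒜) K)
      (unitSubalgebraToUnit_injective K)
  letI nsp : NormedSpace ℂ (𝒜.unitSubalgebra K) :=
    NormedSpace.induced ℂ _ _ (unitSubalgebraToUnit (𝒜 := 𝒜) K)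
  have hiso : Isometry (unitSubalgebraToUnit (𝒜 := 𝒜) K) :=
    AddMonoidHomClass.isometry_of_norm _ fun _ => rfl
  haveI hcomp : CompleteSpace (𝒜.unitSubalgebra K) :=
    (completeSpace_iff_isComplete_range hiso.isUniformInducing).2
      (isClosed_range_unitSubalgebraToUnit hK).isComplete
  { nag, nsp, hcomp, (inferInstance : NonUnitalRing (𝒜.unitSubalgebra K)),
    (inferInstance : StarRing (𝒜.unitSubalgebra K)) with
    norm_mul_le := fun d e => by
      refine norm_toUnit_le _ (mul_nonneg (norm_nonneg _) (norm_nonneg _)) fun x hx => ?_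
      change ‖(d.1 * e.1) x‖ ≤ _
      rw [mul_apply_unit_left d.2.1 _ hx]
      exact (𝒜.norm_mul_le _ _ _).trans (mul_le_mul (norm_apply_le_norm_toUnit _ hx)
        (norm_apply_le_norm_toUnit _ hx) (norm_nonneg _) (norm_nonneg _))
    smul_assoc := smul_assoc
    smul_comm := smul_comm
    star_smul := star_smul
    norm_mul_self_le := fun d => by
      -- On sections over the units the product is pointwise, so the `C*`-identity is inherited from
      -- the fibres.
      have h : ‖toUnit d.1‖ ≤ √‖toUnit (star d.1 * d.1)‖ :=
        norm_toUnit_le _ (Real.sqrt_nonneg _) fun x hx => by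
          refine Real.le_sqrt_of_sq_le ?_
          rw [← norm_adj_mul_self_unit hx, ← star_apply_of_unit hx,
            ← mul_apply_unit_right _ d.2.1 hx]
          exact norm_apply_le_norm_toUnit _ hx
      have h2 := pow_le_pow_left₀ (norm_nonneg _) h 2
      rw [Real.sq_sqrt (norm_nonneg _), sq] at h2
      exact h2 }

/-- Injective homomorphisms of `C*`-algebras are isometric. The section lies in one of the
`C*`-algebras `unitSubalgebra K`, and this replaces the possibly incomplete space of all such
sections. -/
theorem norm_eq_norm_toUnit_of_injective {C : Type u} [NonUnitalCStarAlgebra C]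
    {j : 𝒜.Γc →⋆ₙₐ[ℂ] C} (hj : Function.Injective j) {d : 𝒜.Γc} (hd : d ∈ 𝒜.unitSections) :
    ‖j d‖ = ‖toUnit d‖ := by
  obtain ⟨K, hK, hdK⟩ := exists_mem_unitSubalgebra hd
  let _ : NonUnitalCStarAlgebra (𝒜.unitSubalgebra K) := unitSubalgebraCStar hK
  let jK : 𝒜.unitSubalgebra K →⋆ₙₐ[ℂ] C :=
    { toFun := fun d => j d.1
      map_smul' := fun c d => map_smul j c d.1
      map_zero' := map_zero j
      map_add' := fun d e => map_add j d.1 e.1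
      map_mul' := fun d e => map_mul j d.1 e.1
      map_star' := fun d => map_star j d.1 }
  exact NonUnitalStarAlgHom.norm_map jK (fun d e h => Subtype.ext (hj h)) ⟨d, hdK⟩

/-- A homomorphism that maps `a` to a positive element maps its negative part to zero. -/
theorem map_negPart_eq_zero {A B : Type u} [NonUnitalCStarAlgebra A] [PartialOrder A]
    [StarOrderedRing A] [NonUnitalCStarAlgebra B] [PartialOrder B] [StarOrderedRing B]
    (φ : A →⋆ₙₐ[ℂ] B) {a : A} (ha : IsSelfAdjoint a) (h : 0 ≤ φ a) : φ a⁻ = 0 := by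
  have hpos : ∀ c : A, 0 ≤ c → 0 ≤ φ c := fun c hc => by
    obtain ⟨b, rfl⟩ := CStarAlgebra.nonneg_iff_eq_star_mul_self.1 hc
    rw [map_mul, map_star]
    exact star_mul_self_nonneg _
  have h1 : φ a = φ a⁺ - φ a⁻ := by
    rw [← map_sub, CFC.posPart_sub_negPart a ha]
  have h2 : φ a⁺ * φ a⁻ = 0 := by rw [← map_mul, CFC.posPart_mul_negPart, map_zero]
  -- The images of the two parts of `a` are positive, orthogonal and have difference `φ a`; by
  -- uniqueness they are the parts of `φ a`, whose negative part is zero.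
  rw [← (CFC.posPart_negPart_unique h1 h2 (hpos _ (CFC.posPart_nonneg a))
    (hpos _ (CFC.negPart_nonneg a))).2]
  exact (CFC.negPart_eq_zero_iff _ (ha.map φ)).2 h

/-- The restriction of `f* f` to the unit space is positive. -/
theorem exists_restrictUnit_star_mul_self (f : 𝒜.Γc) :
    ∃ b : 𝒜.Γc, restrictUnit (star f * f) = star b * b := by
  obtain ⟨K, hK, hmem⟩ := exists_mem_unitSubalgebra (restrictUnit_mem (star f * f))
  let _ : NonUnitalCStarAlgebra (𝒜.unitSubalgebra K) := unitSubalgebraCStar hK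
  let _ : PartialOrder (𝒜.unitSubalgebra K) := CStarAlgebra.spectralOrder _
  have : StarOrderedRing (𝒜.unitSubalgebra K) := CStarAlgebra.spectralOrderedRing _
  let a : 𝒜.unitSubalgebra K := ⟨restrictUnit (star f * f), hmem⟩
  have hsa : IsSelfAdjoint a := by
    have h : star (restrictUnit (star f * f)) = restrictUnit (star f * f) :=
      unitSections_ext (star_mem_unitSections (restrictUnit_mem _)) (restrictUnit_mem _)
        fun x hx => by
          rw [star_apply_of_unit hx, restrictUnit_apply_unit _ hx, ← star_apply_of_unit hx,
            star_mul, star_star]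
    exact Subtype.ext h
  -- Evaluation at each unit is a homomorphism onto whose values positivity is known, so the
  -- negative part vanishes at every unit.
  have hneg : a⁻ = 0 := by
    refine Subtype.ext (unitSections_ext (a⁻).2.1 (fun _ _ => rfl) fun x hx => ?_)
    let _ : NonUnitalCStarAlgebra (𝒜.fiber x) := 𝒜.fiberCStar hx
    let _ : PartialOrder (𝒜.fiber x) := CStarAlgebra.spectralOrder _
    have : StarOrderedRing (𝒜.fiber x) := CStarAlgebra.spectralOrderedRing _
    let ev : 𝒜.unitSubalgebra K →⋆ₙₐ[ℂ] 𝒜.fiber x :=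
      { toFun := fun d => d.1 x
        map_smul' := fun c d => rfl
        map_zero' := rfl
        map_add' := fun d e => rfl
        map_mul' := fun d e => mul_apply_unit_left d.2.1 e.1 hx
        map_star' := fun d => star_apply_of_unit hx d.1 }
    refine map_negPart_eq_zero ev hsa ?_
    obtain ⟨b, hb⟩ := exists_star_mul_self_apply_unit f hx
    have h : ev a = star b * b := (restrictUnit_apply_unit _ hx).trans hb
    rw [h]
    exact star_mul_self_nonneg b
  obtain ⟨b, hb⟩ := CStarAlgebra.nonneg_iff_eq_star_mul_self.1
    ((CFC.negPart_eq_zero_iff a hsa).1 hneg)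
  exact ⟨b.1, congrArg Subtype.val hb⟩

end FellBundle

/-! ### Reflection onto the fixed objects of an idempotent monad -/

section

variable {C : Type*} [Category C] {N : C ⥤ C} {η : 𝟭 C ⟶ N}

theorem IsIdempotentMonad.fixedObjects_obj (h : IsIdempotentMonad N η) (X : C) :
    fixedObjects η (N.obj X) := by
  have := h.isIso_map_app X
  rw [h.map_app] at this
  exact this

/-- The reflection onto the fixed objects of an idempotent monad. -/
noncomputable def IsIdempotentMonad.adjunction (h : IsIdempotentMonad N η) :
    (fixedObjects η).lift N h.fixedObjects_obj ⊣ (fixedObjects η).ι :=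
  have hY : ∀ Y : (fixedObjects η).FullSubcategory, IsIso (η.app Y.obj) := fun Y => Y.property
  Adjunction.mkOfUnitCounit
    { unit := { app := fun X => η.app X, naturality := fun _ _ f => η.naturality f }
      counit :=
        { app := fun Y => ⟨@inv _ _ _ _ (η.app Y.obj) (hY Y)⟩
          naturality := fun Y Z f => by
            have := hY Y
            have := hY Z
            ext
            change N.map f.hom ≫ inv (η.app Z.obj) = inv (η.app Y.obj) ≫ f.hom
            rw [IsIso.comp_inv_eq, Category.assoc, IsIso.eq_inv_comp]
            exact (η.naturality f.hom).symm }
      left_triangle := by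
        ext X
        have : IsIso (η.app (N.obj X)) := h.fixedObjects_obj X
        -- The only place in the adjunction where `N η = η N` is used beyond showing that `N X` is
        -- fixed.
        have h1 : N.map (η.app X) ≫ inv (η.app (N.obj X)) = 𝟙 _ := by
          rw [IsIso.comp_inv_eq, Category.id_comp, h.map_app]
        simpa using! h1
      right_triangle := by
        ext Y
        have := hY Y
        simp }

theorem IsIdempotentMonad.exists_adjunction (h : IsIdempotentMonad N η) :
    (∃ (hN : ∀ X, fixedObjects η (N.obj X))
      (adj : (fixedObjects η).lift N hN ⊣ (fixedObjects η).ι),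
      ∀ X, adj.unit.app X = η.app X) ∧
    Nonempty (Reflective (fixedObjects η).ι) :=
  ⟨⟨h.fixedObjects_obj, h.adjunction, fun _ => rfl⟩, ⟨{ L := _, adj := h.adjunction }⟩⟩

end

/-! ### Idempotence of the normalization -/

namespace TopGraded

variable {G : Type u} [TopologicalSpace G] [T2Space G] [EtaleGroupoid G]

/-- `N` chooses `φ^n` from the bundle component alone, and that component of `η_X` is the identity;
the claim is therefore functoriality at an identity, up to unfolding. -/
theorem normalization_map_unit (h₁ : ReducedIsTopological G) (h₂ : ReducedFunctorial G)
    (h₃ : ReducedUniversal G) (X : TopGraded G) :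
    (normalization h₁ h₂).map ((unit h₁ h₂ h₃).app X) =
      𝟙 ((normalization h₁ h₂).obj X) :=
  (normalization h₁ h₂).map_id X

/-- The identity of `C*_r(𝒜)` has the property that characterizes `η` there. -/
theorem unit_app_normalization (h₁ : ReducedIsTopological G) (h₂ : ReducedFunctorial G)
    (h₃ : ReducedUniversal G) (X : TopGraded G) :
    (unit h₁ h₂ h₃).app ((normalization h₁ h₂).obj X) =
      𝟙 ((normalization h₁ h₂).obj X) := by
  refine Hom.ext ?_ rfl
  exact ((h₃ (reduced X.bundle (h₁ X.bundle))).choose_spec.2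
    (NonUnitalStarAlgHom.id ℂ _) fun _ => rfl).symm

theorem isIdempotentMonad_normalization (h₁ : ReducedIsTopological G) (h₂ : ReducedFunctorial G)
    (h₃ : ReducedUniversal G) :
    IsIdempotentMonad (normalization h₁ h₂) (unit h₁ h₂ h₃) where
  map_app X := (normalization_map_unit h₁ h₂ h₃ X).trans (unit_app_normalization h₁ h₂ h₃ X).symm
  isIso_map_app X := by
    have h := normalization_map_unit h₁ h₂ h₃ X
    have : IsIso (𝟙 ((normalization h₁ h₂).obj X)) := inferInstance
    exact h ▸ this

end TopGraded

/-! ### Domination over the units and the conditional expectation -/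

namespace FellBundle

variable {G : Type u} [TopologicalSpace G] [T2Space G] [EtaleGroupoid G] {𝒜 : FellBundle G}

/-- The reduced norm dominates the supremum norm over the unit space. -/
theorem norm_toUnit_le_norm_iRed (f : 𝒜.Γc) : ‖toUnit f‖ ≤ ‖𝒜.iRed f‖ := by
  set u := restrictUnit f with hu_def
  have hu : u ∈ 𝒜.unitSections := restrictUnit_mem f
  have hus := star_mem_unitSections hu
  -- The test vectors are `u*` and `d = u u*`. Over a unit, `f u*` equals `d`, so `⟨d, f u*⟩` takes
  -- the value `d* d` there, of norm `‖f x‖ ^ 4`; Cauchy–Schwarz bounds it by `s ^ 2 * ‖iRed f‖ *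
  -- s`. No approximate unit is needed.
  set d := u * star u with hd_def
  have hd : d ∈ 𝒜.unitSections := mul_mem_unitSections hu hus
  set s := ‖toUnit f‖ with hs_def
  have hs0 : 0 ≤ s := norm_nonneg _
  have hux : ∀ x, rng x = x → ‖u x‖ ≤ s := fun x hx => by
    rw [restrictUnit_apply_unit f hx]
    exact norm_apply_le_norm_toUnit f hx
  have hn2 : norm₂ (star u) ≤ s := by
    rw [norm₂_of_mem hus]
    refine norm_toUnit_le _ hs0 fun x hx => ?_
    rw [star_apply_of_unit hx, norm_adj]
    exact hux x hx
  have hn1 : norm₂ d ≤ s ^ 2 := by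
    rw [norm₂_of_mem hd]
    refine norm_toUnit_le _ (sq_nonneg s) fun x hx => ?_
    rw [mul_apply_unit_left hu _ hx, sq]
    refine (𝒜.norm_mul_le _ _ _).trans ?_
    rw [star_apply_of_unit hx, norm_adj]
    exact mul_le_mul (hux x hx) (hux x hx) (norm_nonneg _) hs0
  have hip : ‖ip d (f * star u)‖ ≤ s ^ 2 * (‖𝒜.iRed f‖ * s) := by
    refine (norm_ip_le' _ _).trans (mul_le_mul hn1 ?_ (norm₂_nonneg _) (sq_nonneg s))
    exact (norm₂_mul_le_iRed f (star u)).trans (mul_le_mul_of_nonneg_left hn2 (norm_nonneg _))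
  have hpt : ∀ x, rng x = x → ‖f x‖ ^ 4 ≤ ‖ip d (f * star u)‖ := by
    intro x hx
    refine le_trans (le_of_eq ?_) (norm_apply_le_norm_toUnit (star d * (f * star u)) hx)
    have hfu : (f * star u) x = d x := by
      rw [mul_apply_unit_right f hus hx, hd_def, mul_apply_unit_right u hus hx,
        restrictUnit_apply_unit f hx]
    rw [mul_apply_unit_left (star_mem_unitSections hd) _ hx, hfu, star_apply_of_unit hx,
      norm_adj_mul_self_unit hx]
    have hdx : ‖d x‖ = ‖f x‖ ^ 2 := by
      have h := norm_adj_mul_self_unit hx (star u x)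
      rw [← star_apply_of_unit hx, star_star, ← mul_apply_unit_left hu _ hx,
        star_apply_of_unit hx u, norm_adj, restrictUnit_apply_unit f hx] at h
      exact h
    rw [hdx, ← pow_mul]
  rcases hs0.eq_or_lt with h0 | h0
  · rw [← h0]; exact norm_nonneg _
  -- The supremum is controlled by bounding each `‖f x‖`, hence the fourth root; raising back to the
  -- fourth power and cancelling `s ^ 3` finishes the case `s > 0`.
  · have h4 : s ≤ √√(s ^ 2 * (‖𝒜.iRed f‖ * s)) :=
      norm_toUnit_le _ (Real.sqrt_nonneg _) fun x hx => by
        refine Real.le_sqrt_of_sq_le (Real.le_sqrt_of_sq_le ?_)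
        rw [← pow_mul]
        exact (hpt x hx).trans hip
    have h5 : s ^ 4 ≤ s ^ 2 * (‖𝒜.iRed f‖ * s) := by
      have h6 := pow_le_pow_left₀ hs0 h4 4
      rwa [show (4 : ℕ) = 2 * 2 from rfl, pow_mul √√_, Real.sq_sqrt (Real.sqrt_nonneg _),
        Real.sq_sqrt (by positivity)] at h6
    refine le_of_mul_le_mul_left (a := s ^ 3) ?_ (by positivity)
    calc s ^ 3 * s = s ^ 4 := by ring
      _ ≤ _ := h5
      _ = _ := by ring

/-- A topological grading dominates the supremum norm over the unit space. -/
theorem IsTopologicalGrading.norm_apply_le {A : Type u} [NonUnitalCStarAlgebra A]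
    {i : 𝒜.Γc →⋆ₙₐ[ℂ] A} (h : IsTopologicalGrading 𝒜 i) (f : 𝒜.Γc) {x : G} (hx : rng x = x) :
    ‖f x‖ ≤ ‖i f‖ := by
  obtain ⟨E, hE, hEi⟩ := h.exists_condExp
  refine (norm_apply_le_norm_toUnit f hx).trans ?_
  -- The supremum over the units is the norm in `A` of `i` of the restricted section, that is, of `E
  -- (i f)`, and `E` is contractive.
  rw [← toUnit_restrictUnit, ← norm_eq_norm_toUnit_of_injective h.injective (restrictUnit_mem f),
    ← hEi]
  exact hE.norm_le _

/-- The norm of `C*_r(𝒜)` is the smallest norm of a topological grading. -/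
theorem IsTopologicalGrading.norm_iRed_le {A : Type u}
    [NonUnitalCStarAlgebra A] {i : 𝒜.Γc →⋆ₙₐ[ℂ] A} (h : IsTopologicalGrading 𝒜 i) (f : 𝒜.Γc) :
    ‖𝒜.iRed f‖ ≤ ‖i f‖ := by
  have h1 := norm_iRed_mapΓ_le (𝟙 𝒜) i (fun u _ hx => h.norm_apply_le u hx) f
  have h2 : Hom.mapΓ (𝟙 𝒜) f = f := rfl
  rwa [h2] at h1

theorem norm_iRed_restrictUnit_le (f : 𝒜.Γc) : ‖𝒜.iRed (restrictUnit f)‖ ≤ ‖𝒜.iRed f‖ := by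
  rw [norm_eq_norm_toUnit_of_injective iRed_injective (restrictUnit_mem f), toUnit_restrictUnit]
  exact norm_toUnit_le_norm_iRed f

theorem isTopologicalGrading_iRed (𝒜 : FellBundle G) : IsTopologicalGrading 𝒜 𝒜.iRed where
  injective := iRed_injective
  denseRange := iRed_denseRange
  exists_condExp := by
    let jl : 𝒜.Γc →ₗ[ℂ] 𝒜.Cr :=
      { toFun := 𝒜.iRed, map_add' := map_add 𝒜.iRed, map_smul' := map_smul 𝒜.iRed }
    have hd : DenseRange 𝒜.iRed := iRed_denseRange
    have hbd : ∀ f, ‖(jl ∘ₗ restrictUnit) f‖ ≤ 1 * ‖jl f‖ := fun f => by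
      rw [one_mul]; exact norm_iRed_restrictUnit_le f
    -- `E` extends restriction to the units by continuity; each property below is checked on
    -- sections and then passes to closures.
    let E := (jl ∘ₗ restrictUnit).extendOfNorm jl
    have hE : ∀ f, E (𝒜.iRed f) = 𝒜.iRed (restrictUnit f) := fun f =>
      LinearMap.extendOfNorm_eq hd ⟨1, hbd⟩ f
    refine ⟨E.toLinearMap, ⟨fun a => ?_, fun d hdD => ?_, fun a => ?_, fun a => ?_,
      fun d hdD a => ?_, fun d hdD a => ?_⟩, hE⟩
    · refine hd.induction_on (p := fun a => E a ∈ closure (𝒜.iRed '' 𝒜.unitSections)) a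
        (isClosed_closure.preimage E.continuous) fun f => ?_
      rw [hE]
      exact subset_closure ⟨_, restrictUnit_mem f, rfl⟩
    · refine closure_minimal (t := {d | E d = d}) ?_
        (isClosed_eq E.continuous continuous_id) hdD
      rintro _ ⟨f, hf, rfl⟩
      change E _ = _
      rw [hE, restrictUnit_of_mem hf]
    · have h := LinearMap.norm_extendOfNorm_apply_le hd 1 hbd a
      rwa [one_mul] at h
    -- The form `star b * b` is not visibly closed under limits, so it is first rewritten as
    -- nonnegativity, which is a closed condition.
    · let _ : PartialOrder 𝒜.Cr := CStarAlgebra.spectralOrder _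
      have : StarOrderedRing 𝒜.Cr := CStarAlgebra.spectralOrderedRing _
      refine CStarAlgebra.nonneg_iff_eq_star_mul_self.1 ?_
      refine hd.induction_on (p := fun a => 0 ≤ E (star a * a)) a
        (CStarAlgebra.isClosed_nonneg.preimage (f := fun a => E (star a * a)) (by fun_prop))
        fun f => ?_
      obtain ⟨b, hb⟩ := exists_restrictUnit_star_mul_self f
      rw [← map_star, ← map_mul, hE, hb, map_mul, map_star]
      exact star_mul_self_nonneg _
    · have hcl : ∀ c, IsClosed {a | E (c * a) = c * E a} := fun c =>
        isClosed_eq (E.continuous.comp (continuous_const_mul c)) (E.continuous.const_mul c)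
      refine closure_minimal (t := {d | E (d * a) = d * E a}) ?_
        (isClosed_eq (E.continuous.comp (continuous_mul_const a)) (continuous_mul_const _)) hdD
      rintro _ ⟨f, hf, rfl⟩
      refine hd.induction_on a (hcl _) fun f' => ?_
      change E (𝒜.iRed f * 𝒜.iRed f') = 𝒜.iRed f * E (𝒜.iRed f')
      rw [← map_mul, hE, hE, restrictUnit_mul_left hf, map_mul]
    · have hcl : ∀ c, IsClosed {a | E (a * c) = E a * c} := fun c =>
        isClosed_eq (E.continuous.comp (continuous_mul_const c)) (E.continuous.mul_const c)
      refine closure_minimal (t := {d | E (a * d) = E a * d}) ?_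
        (isClosed_eq (E.continuous.comp (continuous_const_mul a)) (continuous_const_mul _)) hdD
      rintro _ ⟨f, hf, rfl⟩
      refine hd.induction_on a (hcl _) fun f' => ?_
      change E (𝒜.iRed f' * 𝒜.iRed f) = E (𝒜.iRed f') * 𝒜.iRed f
      rw [← map_mul, hE, hE, restrictUnit_mul_right f' hf, map_mul]

end FellBundle

/-! ### The three existence statements and the theorem -/

namespace TopGraded

variable (G : Type u) [TopologicalSpace G] [T2Space G] [EtaleGroupoid G]

theorem reducedIsTopological : ReducedIsTopological G := isTopologicalGrading_iRed

/-- The comparison is applied with `j` the regular representation of `𝒜`, which dominates the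
supremum over the units. -/
theorem reducedFunctorial : ReducedFunctorial G := fun 𝒜 ℬ φ =>
  existsUnique_starHom_of_norm_le 𝒜.iRed iRed_denseRange (ℬ.iRed.comp (Hom.mapΓ φ)) <|
    norm_iRed_mapΓ_le φ 𝒜.iRed fun u _ hx =>
      (norm_apply_le_norm_toUnit u hx).trans (norm_toUnit_le_norm_iRed u)

theorem reducedUniversal : ReducedUniversal G := fun X =>
  existsUnique_starHom_of_norm_le X.i X.isTopologicalGrading.denseRange X.bundle.iRed
    X.isTopologicalGrading.norm_iRed_le

end TopGraded

theorem mainTheorem2 (G : Type u) [TopologicalSpace G] [T2Space G] [LocallyCompactSpace G]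
    [EtaleGroupoid G] :
    ∃ (h₁ : TopGraded.ReducedIsTopological G) (h₂ : TopGraded.ReducedFunctorial G)
      (h₃ : TopGraded.ReducedUniversal G),
      let N : TopGraded G ⥤ TopGraded G := TopGraded.normalization h₁ h₂
      let η : 𝟭 (TopGraded G) ⟶ N := TopGraded.unit h₁ h₂ h₃
      IsIdempotentMonad N η ∧
      (∃ (hN : ∀ X, fixedObjects η (N.obj X))
        (adj : (fixedObjects η).lift N hN ⊣ (fixedObjects η).ι),
        ∀ X, adj.unit.app X = η.app X) ∧
      Nonempty (Reflective (fixedObjects η).ι) :=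
  have h := TopGraded.isIdempotentMonad_normalization (TopGraded.reducedIsTopological G)
    (TopGraded.reducedFunctorial G) (TopGraded.reducedUniversal G)
  ⟨_, _, _, h, h.exists_adjunction⟩
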